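/- Let $n=2m+1$ with $m\ge 1$, $\lambda=e^{2\pi i/n}$, and let $R_k,S_k$ ($k\in\mathbb Z/n$) be the reflections and rotations of the dihedral group $I_2(n)$: $S_0=1$, $R_kR_l=S_{k-l}$, $S_kS_l=S_{k+l}$, $R_kS_l=R_{k-l}$, $S_kR_l=R_{k+l}$. Put $L_p=\frac1n\sum_k\lambda^{kp}R_k$ and $Q_p=\frac1n\sum_k\lambda^{-kp}S_k$. Let $\mu=n\nu$ and let $\mathcal H=H_{1,\nu}(I_2(n))$ be the unital associative $\mathbb C$-algebra generated by $\mathbb C[I_2(n)]$ and $a^\alpha,b^\alpha$ ($\alpha=0,1$) with relations $L_pa^\alpha=-b^\alpha L_{p+1}$, $L_pb^\alpha=-a^\alpha L_{p-1}$, $Q_pa^\alpha=a^\alpha Q_{p+1}$, $Q_pb^\alpha=b^\alpha Q_{p-1}$, $[a^\alpha,b^\beta]=\varepsilon^{\alpha\beta}(1+\mu L_0)$, $[a^\alpha,a^\beta]=\varepsilon^{\alpha\beta}\mu L_1$, $[b^\alpha,b^\beta]=\varepsilon^{\alpha\beta}\mu L_{-1}$, where $\varepsilon^{\alpha\beta}$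 is skew-symmetric with $\varepsilon^{01}=1$. It is $\mathbb Z_2$-graded with $a^\alpha,b^\alpha$ odd and the group even. Let $\mathfrak s=\frac1{4i}\sum_{\alpha,\beta}(\{a^\alpha,b^\beta\}-\{b^\alpha,a^\beta\})\varepsilon_{\alpha\beta}$ with $\varepsilon_{01}=1$. For $\varkappa=\pm1$, a $\varkappa$-trace is a linear functional $sp^\varkappa:\mathcal H\to\mathbb C$ with $sp^\varkappa(fg)=\varkappa^{\varepsilon(f)\varepsilon(g)}sp^\varkappa(gf)$ for homogeneous $f,g$ of parities $\varepsilon(f),\varepsilon(g)$. For $x,q\in\mathcal H$ write $sp^\varkappa(e^{tx}q):=\sum_{j\ge0}\frac{t^j}{j!}sp^\varkappa(x^jq)$. Let $\mu=n\nu$ be a positive integer not divisible by $n$, let $\tau\in\mathbb C$, $\tau\ne0$. For $\varkappa=\pm1$ let $sp^\varkappa$ be the $\varkappa$-trace on $\mathcal H$ with $$sp^{+1}(S_k)=\frac{\tau}{n\sin^2\frac{\pi k}n}\Bigl(1-\cos\frac{2\pi k\mu}n\Bigr)\ (1\le k\le m),\qquad sp^{-1}(S_k)=\frac{\tau}{n\cos^2\frac{\pi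 k}n}\Bigl(1-(-1)^\mu\cos\frac{2\pi k\mu}n\Bigr)\ (0\le k\le m)$$ (the degenerate trace and supertrace at this $\nu$). Then there are constants $\alpha^0_\ell\in\mathbb C$, $-\mu\le\ell\le\mu$, not depending on $\varkappa$, with $\alpha^0_\mu\ne0$, such that for $\varkappa=\pm1$ and all $t\in\mathbb C$, all series below being convergent: 1. the $\alpha^0_\ell$ are the Laurent coefficients of $F_0$: $\;F_0(t):=sp^\varkappa\bigl(e^{t(\mathfrak s-i\mu L_0)}Q_0\bigr)=\varkappa^\mu\sum_{\ell=-\mu}^{\mu}\alpha^0_\ell\,y^\ell$, where $y=\varkappa e^{it}$; 2. $\mathcal F(t):=sp^\varkappa(e^{t\mathfrak s}Q_0)$ is even in $t$: $\;\mathcal F(-t)=\mathcal F(t)=sp^\varkappa(\cosh(t\mathfrak s)Q_0)$; 3. $\displaystyle \mathcal F(t)=\alpha^0_\mu+\varkappa^\mu\Bigl(\alpha^0_0+2\sum_{\ell=1}^{\mu-1}\varkappa^\ell\alpha^0_\ell\cosh\bigl(t\sqrt{\mu^2-\ell^2}\bigr)\Bigr).$ -/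

import Mathlib

noncomputable section

namespace SRA

/-- Generators: the noncommuting elements `a^α`, `b^α` (`α = 0, 1`) and the elements
`R k` (reflections), `S k` (rotations) of the dihedral group `I₂(n)`, indices modulo `n`. -/
inductive Gen (n : ℕ) : Type
  | a (α : Fin 2) : Gen n
  | b (α : Fin 2) : Gen n
  | R (k : ZMod n) : Gen n
  | S (k : ZMod n) : Gen n

/-- The skew-symmetric tensor with `ε 0 1 = 1` (the same numbers with upper and lower indices). -/
def eps (α β : Fin 2) : ℂ := !![0, 1; -1, 0] α β

/-- `λ ^ k` for `λ = exp (2 π i / n)` and `k` an integer modulo `n`. -/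
def lamPow (n : ℕ) [NeZero n] (k : ZMod n) : ℂ := ZMod.stdAddChar k

/-- `L_p = (1/n) ∑ₖ λ^{kp} R_k`, in the free algebra. -/
def freeL (n : ℕ) [NeZero n] (p : ZMod n) : FreeAlgebra ℂ (Gen n) :=
  (1 / (n : ℂ)) • ∑ k : ZMod n, lamPow n (k * p) • FreeAlgebra.ι ℂ (Gen.R k)

/-- `Q_p = (1/n) ∑ₖ λ^{-kp} S_k`, in the free algebra. -/
def freeQ (n : ℕ) [NeZero n] (p : ZMod n) : FreeAlgebra ℂ (Gen n) :=
  (1 / (n : ℂ)) • ∑ k : ZMod n, lamPow n (-(k * p)) • FreeAlgebra.ι ℂ (Gen.S k)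

open FreeAlgebra in
/-- Defining relations of `H_{1,ν}(I₂(n))`, `n` odd, with `μ = n ν`: the multiplication table of
the group, the relations between the group algebra and the `a^α`, `b^α`, and the commutators. -/
inductive Rel (n : ℕ) [NeZero n] (ν : ℂ) :
    FreeAlgebra ℂ (Gen n) → FreeAlgebra ℂ (Gen n) → Prop
  | S_zero : Rel n ν (ι ℂ (Gen.S 0)) 1
  | RR (k l : ZMod n) : Rel n ν (ι ℂ (Gen.R k) * ι ℂ (Gen.R l)) (ι ℂ (Gen.S (k - l)))
  | SS (k l : ZMod n) : Rel n ν (ι ℂ (Gen.S k) * ι ℂ (Gen.S l)) (ι ℂ (Gen.S (k + l)))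
  | RS (k l : ZMod n) : Rel n ν (ι ℂ (Gen.R k) * ι ℂ (Gen.S l)) (ι ℂ (Gen.R (k - l)))
  | SR (k l : ZMod n) : Rel n ν (ι ℂ (Gen.S k) * ι ℂ (Gen.R l)) (ι ℂ (Gen.R (k + l)))
  | La (p : ZMod n) (α : Fin 2) :
      Rel n ν (freeL n p * ι ℂ (Gen.a α)) (-(ι ℂ (Gen.b α) * freeL n (p + 1)))
  | Lb (p : ZMod n) (α : Fin 2) :
      Rel n ν (freeL n p * ι ℂ (Gen.b α)) (-(ι ℂ (Gen.a α) * freeL n (p - 1)))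
  | Qa (p : ZMod n) (α : Fin 2) :
      Rel n ν (freeQ n p * ι ℂ (Gen.a α)) (ι ℂ (Gen.a α) * freeQ n (p + 1))
  | Qb (p : ZMod n) (α : Fin 2) :
      Rel n ν (freeQ n p * ι ℂ (Gen.b α)) (ι ℂ (Gen.b α) * freeQ n (p - 1))
  | ab (α β : Fin 2) :
      Rel n ν (ι ℂ (Gen.a α) * ι ℂ (Gen.b β) - ι ℂ (Gen.b β) * ι ℂ (Gen.a α))
        (eps α β • (1 + ((n : ℂ) * ν) • freeL n 0))
  | aa (α β : Fin 2) :
      Rel n ν (ι ℂ (Gen.a α) * ι ℂ (Gen.a β) - ι ℂ (Gen.a β) * ι ℂ (Gen.a α))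
        (eps α β • (((n : ℂ) * ν) • freeL n 1))
  | bb (α β : Fin 2) :
      Rel n ν (ι ℂ (Gen.b α) * ι ℂ (Gen.b β) - ι ℂ (Gen.b β) * ι ℂ (Gen.b α))
        (eps α β • (((n : ℂ) * ν) • freeL n (-1)))

/-- The symplectic reflection algebra `H_{1,ν}(I₂(n))`, `n` odd. -/
def H (n : ℕ) [NeZero n] (ν : ℂ) : Type := RingQuot (Rel n ν)

instance (n : ℕ) [NeZero n] (ν : ℂ) : Ring (H n ν) := inferInstanceAs (Ring (RingQuot (Rel n ν)))

instance (n : ℕ) [NeZero n] (ν : ℂ) : Algebra ℂ (H n ν) :=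
  inferInstanceAs (Algebra ℂ (RingQuot (Rel n ν)))

/-- The quotient map from the free algebra. -/
def mk (n : ℕ) [NeZero n] (ν : ℂ) : FreeAlgebra ℂ (Gen n) →ₐ[ℂ] H n ν :=
  RingQuot.mkAlgHom ℂ (Rel n ν)

section elements

variable (n : ℕ) [NeZero n] (ν : ℂ)

/-- The element `a^α`. -/
def a (α : Fin 2) : H n ν := mk n ν (FreeAlgebra.ι ℂ (Gen.a α))

/-- The element `b^α`. -/
def b (α : Fin 2) : H n ν := mk n ν (FreeAlgebra.ι ℂ (Gen.b α))

/-- The reflection `R_k`. -/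
def R (k : ZMod n) : H n ν := mk n ν (FreeAlgebra.ι ℂ (Gen.R k))

/-- The rotation `S_k`. -/
def S (k : ZMod n) : H n ν := mk n ν (FreeAlgebra.ι ℂ (Gen.S k))

/-- `L_p = (1/n) ∑ₖ λ^{kp} R_k`. -/
def L (p : ZMod n) : H n ν := (1 / (n : ℂ)) • ∑ k : ZMod n, lamPow n (k * p) • R n ν k

/-- `Q_p = (1/n) ∑ₖ λ^{-kp} S_k`. -/
def Q (p : ZMod n) : H n ν := (1 / (n : ℂ)) • ∑ k : ZMod n, lamPow n (-(k * p)) • S n ν k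

/-- The singlet `𝔰 = (1/4i) ∑_{α,β} ({a^α, b^β} - {b^α, a^β}) ε_{αβ}`. -/
def sing : H n ν :=
  (1 / (4 * Complex.I)) • ∑ α : Fin 2, ∑ β : Fin 2, eps α β •
    ((a n ν α * b n ν β + b n ν β * a n ν α) - (b n ν α * a n ν β + a n ν β * b n ν α))

/-- Images of the generators under the parity automorphism. -/
def parityGen : Gen n → H n ν
  | Gen.a α => -a n ν α
  | Gen.b α => -b n ν α
  | Gen.R k => R n ν k
  | Gen.S k => S n ν k

lemma mk_freeL (p : ZMod n) : mk n ν (freeL n p) = L n ν p := by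
  simp [freeL, L, R]

lemma mk_freeQ (p : ZMod n) : mk n ν (freeQ n p) = Q n ν p := by
  simp [freeQ, Q, S]

lemma lift_freeL (p : ZMod n) : FreeAlgebra.lift ℂ (parityGen n ν) (freeL n p) = L n ν p := by
  simp [freeL, L, parityGen]

lemma lift_freeQ (p : ZMod n) : FreeAlgebra.lift ℂ (parityGen n ν) (freeQ n p) = Q n ν p := by
  simp [freeQ, Q, parityGen]

lemma mk_rel {x y : FreeAlgebra ℂ (Gen n)} (h : Rel n ν x y) : mk n ν x = mk n ν y :=
  RingQuot.mkAlgHom_rel ℂ h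

lemma parity_rel ⦃x y : FreeAlgebra ℂ (Gen n)⦄ (h : Rel n ν x y) :
    FreeAlgebra.lift ℂ (parityGen n ν) x = FreeAlgebra.lift ℂ (parityGen n ν) y := by
  have h' := mk_rel n ν h
  cases h <;>
    simp only [map_mul, map_neg, map_sub, map_add, map_smul, map_one, mk_freeL, mk_freeQ,
      lift_freeL, lift_freeQ, FreeAlgebra.lift_ι_apply, parityGen, mul_neg, neg_mul,
      neg_neg, neg_inj] at h' ⊢ <;>
    first
      | exact h'
      | exact congrArg Neg.neg h'
      | (rw [neg_eq_iff_eq_neg]; exact h')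

/-- The parity automorphism: `a^α ↦ -a^α`, `b^α ↦ -b^α`, identity on the group. Its eigenspaces
for `1` and `-1` are the even and the odd part of the superalgebra. -/
def parityHom : H n ν →ₐ[ℂ] H n ν :=
  RingQuot.liftAlgHom ℂ ⟨FreeAlgebra.lift ℂ (parityGen n ν), parity_rel n ν⟩

variable {n ν}

/-- `f` is homogeneous of parity `e`. -/
def HasParity (e : Fin 2) (f : H n ν) : Prop := parityHom n ν f = (-1 : ℂ) ^ (e : ℕ) • f

/-- `sp` is a `κ`-trace: a trace for `κ = 1`, a supertrace for `κ = -1`. -/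
def IsKTrace (κ : ℂ) (sp : H n ν →ₗ[ℂ] ℂ) : Prop :=
  ∀ (e e' : Fin 2) (f g : H n ν), HasParity e f → HasParity e' g →
    sp (f * g - κ ^ ((e : ℕ) * (e' : ℕ)) • (g * f)) = 0

/-- The values on rotations that define the trace `tr_z` with parameter `τ`. -/
def HasTraceValues (z : ℤ) (τ : ℂ) (sp : H n ν →ₗ[ℂ] ℂ) : Prop :=
  ∀ k : ℕ, 1 ≤ k → 2 * k < n →
    sp (S n ν (k : ZMod n)) =
      τ / ((n : ℂ) * (Real.sin (Real.pi * k / n) : ℂ) ^ 2) *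
        (1 - (Real.cos (2 * Real.pi * k * z / n) : ℂ))

/-- The values on rotations that define the supertrace `str_z` with parameter `τ`. -/
def HasSupertraceValues (z : ℤ) (τ : ℂ) (sp : H n ν →ₗ[ℂ] ℂ) : Prop :=
  ∀ k : ℕ, 2 * k < n →
    sp (S n ν (k : ZMod n)) =
      τ / ((n : ℂ) * (Real.cos (Real.pi * k / n) : ℂ) ^ 2) *
        (1 - (-1 : ℂ) ^ z * (Real.cos (2 * Real.pi * k * z / n) : ℂ))

/-- `sp` is a `κ`-trace with the defining values with parameters `z`, `τ`: `tr_z` if `κ = 1`,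
`str_z` if `κ = -1` (for `n ν = z`, `n ∤ z`, `τ ≠ 0` these are the degenerate `κ`-traces). -/
structure IsSpZ (κ : ℂ) (z : ℤ) (τ : ℂ) (sp : H n ν →ₗ[ℂ] ℂ) : Prop where
  isKTrace : IsKTrace κ sp
  trace_values : κ = 1 → HasTraceValues z τ sp
  supertrace_values : κ = -1 → HasSupertraceValues z τ sp

/-- The `j`-th term of the expansion of `sp (exp (t x) q)` in powers of `t`. -/
def expTerm (sp : H n ν →ₗ[ℂ] ℂ) (x q : H n ν) (t : ℂ) (j : ℕ) : ℂ :=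
  t ^ j / (j.factorial : ℂ) * sp (x ^ j * q)

/-- The generating function `t ↦ sp (exp (t x) q)`. -/
def expGen (sp : H n ν →ₗ[ℂ] ℂ) (x q : H n ν) (t : ℂ) : ℂ := ∑' j : ℕ, expTerm sp x q t j

end elements

end SRA

end

/-! Everything is read off the moments `M_p(j) = sp ((𝔰 - iμL₀)^j Q_p)`, which turn out to be finite
sums of point evaluations at integers. The element `a^α` acts as a ladder operator, `(𝔰 - iμL₀) a^α
= a^α (𝔰 + iμL₀ + i)`, and `a⁰b¹ - a¹b⁰`, `b¹a⁰ - b⁰a¹` are affine in `𝔰 ∓ iμL₀`. Moving `a^α`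
cyclically around the `κ`-trace therefore gives a recursion between the moments of `𝔰 - iμL₀` on
`Q_p` and those of `𝔰 + iμL₀` on `Q_{p+1}` (`IsKTrace.moment_recursion`). The recursion closes: for
`p ≠ 0` the two elements agree on `Q_p`, because `L₀Q_p = 0`; for `p = 0` conjugation by `L₀`
exchanges them up to sign, and the odd moments depend only on `sp L₀`. Homogeneous solutions whose
zeroth moments satisfy `D_p(0) = κ D_{p+1}(0)` vanish (`moment_recursion_unique`). On the other hand
`model` solves the recursion, since shifting `l` by one moves the residue class modulo `n` by one
and boundary terms cancel. Its zeroth moments match because the prescribed values on rotations are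
values of the Fejér kernel at `κλ^k`. Hence `IsSpZ.moment_eq`: the moments are those of `model`,
scaled by `2τ/n`. At `p = 0` this is a measure on `-μ ≤ l ≤ μ` with weights `κ^μ κ^l α_l`, where
`α_l = (2τ/n)|l|` if `|l| ≡ μ` modulo `n` and `l ≠ -μ`, and `α_l = 0` otherwise. It gives the
Laurent polynomial for `F₀`. Finally `(𝔰 - iμL₀)² = 𝔰² - μ²Q₀`, so on `Q₀` the value `(il)²` becomes
`μ² - l²` for `𝔰²`, while odd powers of `𝔰` have zero trace because `L₀` anticommutes with `𝔰`. This
turns exponentials into `cosh (t √(μ² - l²))`. -/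

namespace SRA

/-! ### Relations in the algebra and the singlet as a ladder-type element -/

section relations

variable (n : ℕ) [NeZero n] (ν : ℂ)

lemma S_zero : S n ν 0 = 1 := by
  have h := mk_rel n ν Rel.S_zero
  rw [map_one] at h
  exact h

lemma R_mul_R (k l : ZMod n) : R n ν k * R n ν l = S n ν (k - l) := by
  have h := mk_rel n ν (Rel.RR k l)
  rw [map_mul] at h
  exact h

lemma R_mul_S (k l : ZMod n) : R n ν k * S n ν l = R n ν (k - l) := by
  have h := mk_rel n ν (Rel.RS k l)
  rw [map_mul] at h
  exact h

lemma S_mul_R (k l : ZMod n) : S n ν k * R n ν l = R n ν (k + l) := by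
  have h := mk_rel n ν (Rel.SR k l)
  rw [map_mul] at h
  exact h

lemma L_mul_a (p : ZMod n) (α : Fin 2) : L n ν p * a n ν α = -(b n ν α * L n ν (p + 1)) := by
  have h := mk_rel n ν (Rel.La p α)
  simp only [map_mul, map_neg, mk_freeL] at h
  exact h

lemma L_mul_b (p : ZMod n) (α : Fin 2) : L n ν p * b n ν α = -(a n ν α * L n ν (p - 1)) := by
  have h := mk_rel n ν (Rel.Lb p α)
  simp only [map_mul, map_neg, mk_freeL] at h
  exact h

lemma Q_mul_a (p : ZMod n) (α : Fin 2) : Q n ν p * a n ν α = a n ν α * Q n ν (p + 1) := by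
  have h := mk_rel n ν (Rel.Qa p α)
  simp only [map_mul, mk_freeQ] at h
  exact h

lemma Q_mul_b (p : ZMod n) (α : Fin 2) : Q n ν p * b n ν α = b n ν α * Q n ν (p - 1) := by
  have h := mk_rel n ν (Rel.Qb p α)
  simp only [map_mul, mk_freeQ] at h
  exact h

lemma a_mul_b_sub (α β : Fin 2) : a n ν α * b n ν β - b n ν β * a n ν α =
    eps α β • (1 + ((n : ℂ) * ν) • L n ν 0) := by
  have h := mk_rel n ν (Rel.ab α β)
  simp only [map_mul, map_sub, map_add, map_smul, map_one, mk_freeL] at h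
  exact h

lemma a_mul_a_sub (α β : Fin 2) : a n ν α * a n ν β - a n ν β * a n ν α =
    eps α β • (((n : ℂ) * ν) • L n ν 1) := by
  have h := mk_rel n ν (Rel.aa α β)
  simp only [map_mul, map_sub, map_smul, mk_freeL] at h
  exact h

@[simp] lemma eps_zero_zero : eps 0 0 = 0 := by simp [eps]
@[simp] lemma eps_zero_one : eps 0 1 = 1 := by simp [eps]
@[simp] lemma eps_one_zero : eps 1 0 = -1 := by simp [eps]
@[simp] lemma eps_one_one : eps 1 1 = 0 := by simp [eps]

lemma I_smul_sing_eq_half : Complex.I • sing n ν = (1 / 2 : ℂ) •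
    ((a n ν 0 * b n ν 1 + b n ν 1 * a n ν 0) - (a n ν 1 * b n ν 0 + b n ν 0 * a n ν 1)) := by
  have hc : Complex.I * (1 / (4 * Complex.I)) = 1 / 4 := by
    field_simp [Complex.I_ne_zero]
  rw [sing, smul_smul, hc]
  simp only [Fin.sum_univ_two, eps_zero_zero, eps_zero_one, eps_one_zero, eps_one_one]
  module

/-- `i 𝔰 + 1 + μ L₀ = a⁰ b¹ - a¹ b⁰`. -/
lemma I_smul_sing_eq_ab : Complex.I • sing n ν =
    a n ν 0 * b n ν 1 - a n ν 1 * b n ν 0 - (1 + ((n : ℂ) * ν) • L n ν 0) := by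
  have h1 := a_mul_b_sub n ν 0 1
  have h2 := a_mul_b_sub n ν 1 0
  rw [eps_zero_one, sub_eq_iff_eq_add] at h1
  rw [eps_one_zero, sub_eq_iff_eq_add] at h2
  rw [I_smul_sing_eq_half, h1, h2]
  module

/-- `i 𝔰 - 1 - μ L₀ = b¹ a⁰ - b⁰ a¹`. -/
lemma I_smul_sing_eq_ba : Complex.I • sing n ν =
    b n ν 1 * a n ν 0 - b n ν 0 * a n ν 1 + (1 + ((n : ℂ) * ν) • L n ν 0) := by
  have h1 := a_mul_b_sub n ν 0 1
  have h2 := a_mul_b_sub n ν 1 0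
  rw [eps_zero_one, sub_eq_iff_eq_add] at h1
  rw [eps_one_zero, sub_eq_iff_eq_add] at h2
  rw [I_smul_sing_eq_half, h1, h2]
  module

lemma eq_of_I_smul_eq {x y : H n ν} (h : Complex.I • x = Complex.I • y) : x = y := by
  have h' := congrArg (fun z => (-Complex.I) • z) h
  simpa [smul_smul] using h'

lemma L_mul_ab (p : ZMod n) (α β : Fin 2) :
    L n ν p * (a n ν α * b n ν β) = b n ν α * a n ν β * L n ν p := by
  rw [← mul_assoc, L_mul_a, neg_mul, mul_assoc, L_mul_b]
  simp [mul_assoc]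

lemma L_mul_ba (p : ZMod n) (α β : Fin 2) :
    L n ν p * (b n ν α * a n ν β) = a n ν α * b n ν β * L n ν p := by
  rw [← mul_assoc, L_mul_b, neg_mul, mul_assoc, L_mul_a]
  simp [mul_assoc]

lemma Q_mul_ab (p : ZMod n) (α β : Fin 2) :
    Q n ν p * (a n ν α * b n ν β) = a n ν α * b n ν β * Q n ν p := by
  rw [← mul_assoc, Q_mul_a, mul_assoc, Q_mul_b]
  simp [mul_assoc]

lemma Q_mul_ba (p : ZMod n) (α β : Fin 2) :
    Q n ν p * (b n ν α * a n ν β) = b n ν α * a n ν β * Q n ν p := by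
  rw [← mul_assoc, Q_mul_b, mul_assoc, Q_mul_a]
  simp [mul_assoc]

lemma L_mul_sing (p : ZMod n) : L n ν p * sing n ν = -(sing n ν * L n ν p) := by
  apply eq_of_I_smul_eq
  rw [← mul_smul_comm, smul_neg, ← smul_mul_assoc, I_smul_sing_eq_half, mul_smul_comm,
    smul_mul_assoc, ← smul_neg]
  congr 1
  simp only [mul_sub, mul_add, sub_mul, add_mul, L_mul_ab, L_mul_ba]
  abel

lemma Q_mul_sing (p : ZMod n) : Q n ν p * sing n ν = sing n ν * Q n ν p := by
  apply eq_of_I_smul_eq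
  rw [← mul_smul_comm, ← smul_mul_assoc, I_smul_sing_eq_half, mul_smul_comm, smul_mul_assoc]
  congr 1
  simp only [mul_sub, mul_add, sub_mul, add_mul, Q_mul_ab, Q_mul_ba]

/-- `𝔰 - i μ L₀`. -/
noncomputable def singSub : H n ν := sing n ν - (Complex.I * (n * ν)) • L n ν 0

/-- `𝔰 + i μ L₀`. -/
noncomputable def singAdd : H n ν := sing n ν + (Complex.I * (n * ν)) • L n ν 0

lemma I_smul_singSub : Complex.I • singSub n ν = a n ν 0 * b n ν 1 - a n ν 1 * b n ν 0 - 1 := by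
  have h : Complex.I * (Complex.I * (n * ν)) = -(n * ν) := by
    rw [← mul_assoc, Complex.I_mul_I]; ring
  rw [singSub, smul_sub, smul_smul, h, I_smul_sing_eq_ab]
  module

lemma I_smul_singAdd : Complex.I • singAdd n ν = b n ν 1 * a n ν 0 - b n ν 0 * a n ν 1 + 1 := by
  have h : Complex.I * (Complex.I * (n * ν)) = -(n * ν) := by
    rw [← mul_assoc, Complex.I_mul_I]; ring
  rw [singAdd, smul_add, smul_smul, h, I_smul_sing_eq_ba]
  module

/-- The ladder relation behind the whole proof. Commuting `a^α` through `a⁰b¹ - a¹b⁰` produces a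
term in `L₁` from `[a⁰, a¹]`; since `L₁ b^α = -a^α L₀`, it becomes a multiple of `a^α L₀` and
combines with the `L₀` in `[a, b]`. -/
lemma singSub_mul_a (α : Fin 2) :
    singSub n ν * a n ν α = a n ν α * (singAdd n ν + algebraMap ℂ _ Complex.I) := by
  apply eq_of_I_smul_eq
  have hI : Complex.I • algebraMap ℂ (H n ν) Complex.I = -1 := by
    rw [Algebra.algebraMap_eq_smul_one, smul_smul, Complex.I_mul_I, neg_one_smul]
  rw [← smul_mul_assoc, ← mul_smul_comm, smul_add, I_smul_singSub, I_smul_singAdd, hI]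
  have h00 := a_mul_b_sub n ν 0 0
  have h01 := a_mul_b_sub n ν 0 1
  have h10 := a_mul_b_sub n ν 1 0
  have h11 := a_mul_b_sub n ν 1 1
  have h := a_mul_a_sub n ν 0 1
  have hL := L_mul_b n ν 1 α
  rw [sub_self] at hL
  simp only [eps_zero_zero, eps_zero_one, eps_one_zero, eps_one_one, zero_smul, one_smul,
    neg_one_smul] at h00 h01 h10 h11 h
  rw [sub_eq_zero] at h00 h11
  rw [sub_eq_iff_eq_add] at h
  have h10' : b n ν 0 * a n ν 1 = a n ν 1 * b n ν 0 + (1 + ((n : ℂ) * ν) • L n ν 0) := by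
    rw [sub_eq_iff_eq_add] at h10
    rw [h10]; abel
  have h01' : b n ν 1 * a n ν 0 = a n ν 0 * b n ν 1 - (1 + ((n : ℂ) * ν) • L n ν 0) := by
    rw [← h01]; abel
  fin_cases α
  · simp only [Fin.zero_eta] at hL ⊢
    have e : a n ν 0 * (a n ν 1 * b n ν 0) =
        a n ν 1 * (a n ν 0 * b n ν 0) - ((n : ℂ) * ν) • (a n ν 0 * L n ν 0) := by
      rw [← mul_assoc, h, add_mul, smul_mul_assoc, hL, mul_assoc]
      module
    rw [sub_mul, sub_mul, mul_assoc, mul_assoc (a n ν 1), ← h00, mul_add, mul_add, mul_sub, h10',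
      mul_add, e, mul_add, mul_smul_comm]
    simp only [mul_one, one_mul, mul_neg]
    abel
  · simp only [Fin.mk_one] at hL ⊢
    have e : a n ν 0 * (a n ν 1 * b n ν 1) =
        a n ν 1 * (a n ν 0 * b n ν 1) - ((n : ℂ) * ν) • (a n ν 1 * L n ν 0) := by
      rw [← mul_assoc, h, add_mul, smul_mul_assoc, hL, mul_assoc]
      module
    rw [sub_mul, sub_mul, mul_assoc, ← h11, e, mul_assoc, mul_add, mul_add, mul_sub, h01',
      mul_sub, mul_add, mul_smul_comm]
    simp only [mul_one, one_mul, mul_neg]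
    abel

/-! ### Products in the Fourier basis of the group algebra -/

lemma lamPow_add (k l : ZMod n) : lamPow n (k + l) = lamPow n k * lamPow n l :=
  AddChar.map_add_eq_mul _ _ _

@[simp] lemma lamPow_zero : lamPow n 0 = 1 := AddChar.map_zero_eq_one _

lemma sum_lamPow_mul (p : ZMod n) : ∑ k : ZMod n, lamPow n (k * p) = if p = 0 then (n : ℂ) else 0 := by
  have h := AddChar.sum_mulShift p (ZMod.isPrimitive_stdAddChar n)
  simpa [lamPow, ZMod.card] using h

lemma L_mul_L (p q : ZMod n) : L n ν p * L n ν q = if p + q = 0 then Q n ν q else 0 := by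
  have hn : (n : ℂ) ≠ 0 := Nat.cast_ne_zero.2 (NeZero.ne n)
  -- Reindexing by `j = k - l` separates the double sum; the sum over `l` is then character
  -- orthogonality.
  have h : ∀ l : ZMod n, ∑ k : ZMod n, (lamPow n (k * p) * lamPow n (l * q)) • S n ν (k - l) =
      ∑ j : ZMod n, (lamPow n (j * p) * lamPow n (l * (p + q))) • S n ν j := by
    intro l
    rw [← Equiv.sum_comp (Equiv.subRight l)
      (fun j => (lamPow n (j * p) * lamPow n (l * (p + q))) • S n ν j)]
    refine Finset.sum_congr rfl fun k _ => ?_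
    rw [Equiv.subRight_apply, ← lamPow_add, ← lamPow_add]
    congr 2; ring
  rw [L, L, smul_mul_smul_comm, Finset.sum_mul_sum, Finset.sum_comm]
  simp only [smul_mul_smul_comm, R_mul_R]
  simp only [h]
  rw [Finset.sum_comm]
  simp only [← Finset.sum_smul, ← Finset.mul_sum, sum_lamPow_mul]
  split_ifs with hpq
  · have hp : p = -q := by linear_combination hpq
    rw [Q, Finset.smul_sum, Finset.smul_sum]
    refine Finset.sum_congr rfl fun j _ => ?_
    rw [smul_smul, smul_smul, hp, mul_neg]
    congr 1
    field_simp
  · simp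

lemma L_mul_Q (p q : ZMod n) : L n ν p * Q n ν q = if p = q then L n ν q else 0 := by
  have hn : (n : ℂ) ≠ 0 := Nat.cast_ne_zero.2 (NeZero.ne n)
  have h : ∀ l : ZMod n, ∑ k : ZMod n, (lamPow n (k * p) * lamPow n (-(l * q))) • R n ν (k - l) =
      ∑ j : ZMod n, (lamPow n (j * p) * lamPow n (l * (p - q))) • R n ν j := by
    intro l
    rw [← Equiv.sum_comp (Equiv.subRight l)
      (fun j => (lamPow n (j * p) * lamPow n (l * (p - q))) • R n ν j)]
    refine Finset.sum_congr rfl fun k _ => ?_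
    rw [Equiv.subRight_apply, ← lamPow_add, ← lamPow_add]
    congr 2; ring
  rw [L, Q, smul_mul_smul_comm, Finset.sum_mul_sum, Finset.sum_comm]
  simp only [smul_mul_smul_comm, R_mul_S]
  simp only [h]
  rw [Finset.sum_comm]
  simp only [← Finset.sum_smul, ← Finset.mul_sum, sum_lamPow_mul, sub_eq_zero]
  split_ifs with hpq
  · rw [L, Finset.smul_sum, Finset.smul_sum]
    refine Finset.sum_congr rfl fun j _ => ?_
    rw [smul_smul, smul_smul, hpq]
    congr 1
    field_simp
  · simp

lemma Q_mul_L (p q : ZMod n) : Q n ν p * L n ν q = if p + q = 0 then L n ν q else 0 := by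
  have hn : (n : ℂ) ≠ 0 := Nat.cast_ne_zero.2 (NeZero.ne n)
  have h : ∀ k : ZMod n, ∑ l : ZMod n, (lamPow n (-(k * p)) * lamPow n (l * q)) • R n ν (k + l) =
      ∑ j : ZMod n, (lamPow n (j * q) * lamPow n (k * (-(p + q)))) • R n ν j := by
    intro k
    rw [← Equiv.sum_comp (Equiv.addLeft k)
      (fun j => (lamPow n (j * q) * lamPow n (k * (-(p + q)))) • R n ν j)]
    refine Finset.sum_congr rfl fun l _ => ?_
    rw [Equiv.coe_addLeft, ← lamPow_add, ← lamPow_add]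
    congr 2; ring
  rw [L, Q, smul_mul_smul_comm, Finset.sum_mul_sum]
  simp only [smul_mul_smul_comm, S_mul_R]
  simp only [h]
  rw [Finset.sum_comm]
  simp only [← Finset.sum_smul, ← Finset.mul_sum, sum_lamPow_mul, neg_eq_zero]
  split_ifs with hpq
  · rw [Finset.smul_sum, Finset.smul_sum]
    refine Finset.sum_congr rfl fun j _ => ?_
    rw [smul_smul, smul_smul]
    congr 1
    field_simp
  · simp

lemma parityHom_mk (x : FreeAlgebra ℂ (Gen n)) :
    parityHom n ν (mk n ν x) = FreeAlgebra.lift ℂ (parityGen n ν) x :=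
  RingQuot.liftAlgHom_mkAlgHom_apply ..

end relations

/-! ### Parity and cyclicity of the `κ`-trace -/

section parity

variable {n : ℕ} [NeZero n] {ν : ℂ}

@[simp] lemma parityHom_a (α : Fin 2) : parityHom n ν (a n ν α) = -a n ν α := by
  rw [a, parityHom_mk, FreeAlgebra.lift_ι_apply]; rfl

@[simp] lemma parityHom_b (α : Fin 2) : parityHom n ν (b n ν α) = -b n ν α := by
  rw [b, parityHom_mk, FreeAlgebra.lift_ι_apply]; rfl

@[simp] lemma parityHom_R (k : ZMod n) : parityHom n ν (R n ν k) = R n ν k := by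
  rw [R, parityHom_mk, FreeAlgebra.lift_ι_apply]; rfl

@[simp] lemma parityHom_S (k : ZMod n) : parityHom n ν (S n ν k) = S n ν k := by
  rw [S, parityHom_mk, FreeAlgebra.lift_ι_apply]; rfl

@[simp] lemma parityHom_L (p : ZMod n) : parityHom n ν (L n ν p) = L n ν p := by
  rw [← mk_freeL, parityHom_mk, lift_freeL, mk_freeL]

@[simp] lemma parityHom_Q (p : ZMod n) : parityHom n ν (Q n ν p) = Q n ν p := by
  rw [← mk_freeQ, parityHom_mk, lift_freeQ, mk_freeQ]

@[simp] lemma parityHom_sing : parityHom n ν (sing n ν) = sing n ν := by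
  apply eq_of_I_smul_eq
  rw [← map_smul, I_smul_sing_eq_ab]
  simp

@[simp] lemma parityHom_singSub : parityHom n ν (singSub n ν) = singSub n ν := by
  simp [singSub]

@[simp] lemma parityHom_singAdd : parityHom n ν (singAdd n ν) = singAdd n ν := by
  simp [singAdd]

variable {κ : ℂ} {sp : H n ν →ₗ[ℂ] ℂ}

lemma IsKTrace.mul_comm_even (h : IsKTrace κ sp) {f g : H n ν} (hf : parityHom n ν f = f)
    (hg : parityHom n ν g = g) : sp (f * g) = sp (g * f) := by
  have := h 0 0 f g (by simpa [HasParity] using hf) (by simpa [HasParity] using hg)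
  simpa [sub_eq_zero] using this

lemma IsKTrace.mul_comm_odd (h : IsKTrace κ sp) {f g : H n ν} (hf : parityHom n ν f = -f)
    (hg : parityHom n ν g = -g) : sp (f * g) = κ * sp (g * f) := by
  have := h 1 1 f g (by simpa [HasParity] using hf) (by simpa [HasParity] using hg)
  simpa [sub_eq_zero] using this

end parity

/-! ### Moments of `𝔰 ∓ iμL₀` under a `κ`-trace -/

section moments

variable {n : ℕ} [NeZero n] {ν : ℂ}

lemma commute_Q_sing (p : ZMod n) : Commute (Q n ν p) (sing n ν) := Q_mul_sing n ν p

lemma commute_Q_L_zero (p : ZMod n) : Commute (Q n ν p) (L n ν 0) := by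
  rw [Commute, SemiconjBy, Q_mul_L, L_mul_Q]
  by_cases hp : p = 0
  · simp [hp]
  · simp [hp, Ne.symm hp]

lemma commute_Q_singSub (p : ZMod n) : Commute (Q n ν p) (singSub n ν) :=
  (commute_Q_sing p).sub_right ((commute_Q_L_zero p).smul_right _)

lemma commute_Q_singAdd (p : ZMod n) : Commute (Q n ν p) (singAdd n ν) :=
  (commute_Q_sing p).add_right ((commute_Q_L_zero p).smul_right _)

lemma L_zero_mul_L_zero : L n ν 0 * L n ν 0 = Q n ν 0 := by simp [L_mul_L]

lemma L_zero_mul_Q_zero : L n ν 0 * Q n ν 0 = L n ν 0 := by simp [L_mul_Q]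

lemma singAdd_mul_L_zero : singAdd n ν * L n ν 0 = -(L n ν 0 * singSub n ν) := by
  rw [singAdd, singSub, add_mul, mul_sub, L_mul_sing, smul_mul_assoc, mul_smul_comm]
  abel

lemma singAdd_pow_mul_L_zero (j : ℕ) :
    singAdd n ν ^ j * L n ν 0 = (-1 : ℂ) ^ j • (L n ν 0 * singSub n ν ^ j) := by
  induction j with
  | zero => simp
  | succ j ih =>
    rw [pow_succ', mul_assoc, ih, mul_smul_comm, ← mul_assoc, singAdd_mul_L_zero, neg_mul,
      mul_assoc, ← pow_succ', smul_neg, pow_succ (-1 : ℂ), mul_neg_one, neg_smul]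

lemma singSub_pow_mul_Q {p : ZMod n} (hp : p ≠ 0) (j : ℕ) :
    singSub n ν ^ j * Q n ν p = sing n ν ^ j * Q n ν p := by
  induction j with
  | zero => simp
  | succ j ih =>
    rw [pow_succ', mul_assoc, ih, singSub, sub_mul, smul_mul_assoc,
      ← ((commute_Q_sing p).pow_right j).eq, ← mul_assoc (L n ν 0), L_mul_Q, if_neg hp.symm,
      zero_mul, smul_zero, sub_zero, (commute_Q_sing p).pow_right j, pow_succ', mul_assoc]

lemma singAdd_pow_mul_Q {p : ZMod n} (hp : p ≠ 0) (j : ℕ) :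
    singAdd n ν ^ j * Q n ν p = sing n ν ^ j * Q n ν p := by
  induction j with
  | zero => simp
  | succ j ih =>
    rw [pow_succ', mul_assoc, ih, singAdd, add_mul, smul_mul_assoc,
      ← ((commute_Q_sing p).pow_right j).eq, ← mul_assoc (L n ν 0), L_mul_Q, if_neg hp.symm,
      zero_mul, smul_zero, add_zero, (commute_Q_sing p).pow_right j, pow_succ', mul_assoc]

/-- `(𝔰 - i μ L₀)² = 𝔰² - μ² Q₀`. -/
lemma singSub_sq : singSub n ν ^ 2 = sing n ν ^ 2 - ((n : ℂ) * ν) ^ 2 • Q n ν 0 := by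
  have hI : (Complex.I * (n * ν)) * (Complex.I * (n * ν)) = -((n * ν) ^ 2) := by
    linear_combination ((n : ℂ) * ν) ^ 2 * Complex.I_mul_I
  rw [singSub, sq, sub_mul, mul_sub, mul_sub, smul_mul_smul_comm, hI, L_zero_mul_L_zero,
    smul_mul_assoc, L_mul_sing, mul_smul_comm, sq (sing n ν)]
  module

lemma commute_sing_singSub_sq : Commute (sing n ν) (singSub n ν ^ 2) := by
  rw [singSub_sq]
  exact ((Commute.refl _).pow_right 2).sub_right ((commute_Q_sing 0).symm.smul_right _)

lemma commute_L_zero_sing_sq : Commute (L n ν 0) (sing n ν ^ 2) := by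
  rw [Commute, SemiconjBy, sq, ← mul_assoc, L_mul_sing, neg_mul, mul_assoc, L_mul_sing, mul_neg,
    neg_neg, mul_assoc]

lemma commute_L_zero_singSub_sq : Commute (L n ν 0) (singSub n ν ^ 2) := by
  rw [singSub_sq]
  exact commute_L_zero_sing_sq.sub_right ((commute_Q_L_zero 0).symm.smul_right _)

lemma singAdd_add_I_pow (j : ℕ) : (singAdd n ν + algebraMap ℂ _ Complex.I) ^ j =
    ∑ m ∈ Finset.range (j + 1), ((j.choose m : ℂ) * Complex.I ^ (j - m)) • singAdd n ν ^ m := by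
  have hc : Commute (singAdd n ν) (algebraMap ℂ _ Complex.I) :=
    (Algebra.commutes Complex.I (singAdd n ν)).symm
  rw [hc.add_pow]
  refine Finset.sum_congr rfl fun m _ => ?_
  rw [← map_pow, ← map_natCast (algebraMap ℂ (H n ν)), mul_assoc, ← map_mul, ← Algebra.commutes,
    ← Algebra.smul_def, mul_comm]

lemma singSub_pow_mul_a (j : ℕ) (α : Fin 2) : singSub n ν ^ j * a n ν α =
    a n ν α * (singAdd n ν + algebraMap ℂ _ Complex.I) ^ j :=
  ((show SemiconjBy (a n ν α) (singAdd n ν + algebraMap ℂ _ Complex.I) (singSub n ν) from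
    (singSub_mul_a n ν α).symm).pow_right j).symm

variable {κ : ℂ} {sp : H n ν →ₗ[ℂ] ℂ}

/-- The factor `a^α` is pulled to the far left by the ladder relation, then carried cyclically to
the far right; both sides of the cut are odd, hence the factor `κ`. -/
lemma IsKTrace.singSub_pow_mul_Q_mul_ab (h : IsKTrace κ sp) (p : ZMod n) (j : ℕ) (α β : Fin 2) :
    sp (singSub n ν ^ j * Q n ν p * (a n ν α * b n ν β)) =
      κ * sp ((singAdd n ν + algebraMap ℂ _ Complex.I) ^ j * Q n ν (p + 1) *
        (b n ν β * a n ν α)) := by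
  have e : singSub n ν ^ j * Q n ν p * (a n ν α * b n ν β) =
      a n ν α * ((singAdd n ν + algebraMap ℂ _ Complex.I) ^ j * Q n ν (p + 1) * b n ν β) := by
    rw [mul_assoc, ← mul_assoc (Q n ν p), Q_mul_a, mul_assoc, ← mul_assoc, singSub_pow_mul_a,
      mul_assoc, mul_assoc]
  rw [e, h.mul_comm_odd (by simp) (by simp [AlgHom.commutes]), mul_assoc _ (b n ν β)]

/-- The recursion relating the moments of `𝔰 ∓ i μ L₀` on `Q_p` and on `Q_{p+1}`. -/
lemma IsKTrace.moment_recursion (h : IsKTrace κ sp) (p : ZMod n) (j : ℕ) :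
    Complex.I * sp (singSub n ν ^ (j + 1) * Q n ν p) + sp (singSub n ν ^ j * Q n ν p) =
      κ * ∑ m ∈ Finset.range (j + 1), (j.choose m : ℂ) * Complex.I ^ (j - m) *
        (Complex.I * sp (singAdd n ν ^ (m + 1) * Q n ν (p + 1)) -
          sp (singAdd n ν ^ m * Q n ν (p + 1))) := by
  have e1 : Complex.I • (singSub n ν ^ (j + 1) * Q n ν p) + singSub n ν ^ j * Q n ν p =
      singSub n ν ^ j * Q n ν p * (a n ν 0 * b n ν 1) -
        singSub n ν ^ j * Q n ν p * (a n ν 1 * b n ν 0) := by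
    have h1 : a n ν 0 * b n ν 1 - a n ν 1 * b n ν 0 = Complex.I • singSub n ν + 1 := by
      rw [I_smul_singSub]; abel
    rw [← mul_sub, h1, mul_add, mul_one, mul_smul_comm, mul_assoc, (commute_Q_singSub p).eq,
      ← mul_assoc, pow_succ]
  have e2 : (singAdd n ν + algebraMap ℂ _ Complex.I) ^ j * Q n ν (p + 1) * (b n ν 1 * a n ν 0) -
      (singAdd n ν + algebraMap ℂ _ Complex.I) ^ j * Q n ν (p + 1) * (b n ν 0 * a n ν 1) =
      ∑ m ∈ Finset.range (j + 1), ((j.choose m : ℂ) * Complex.I ^ (j - m)) •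
        (Complex.I • (singAdd n ν ^ (m + 1) * Q n ν (p + 1)) -
          singAdd n ν ^ m * Q n ν (p + 1)) := by
    have h1 : b n ν 1 * a n ν 0 - b n ν 0 * a n ν 1 = Complex.I • singAdd n ν - 1 := by
      rw [I_smul_singAdd]; abel
    rw [← mul_sub, h1, singAdd_add_I_pow, Finset.sum_mul, Finset.sum_mul]
    refine Finset.sum_congr rfl fun m _ => ?_
    rw [smul_mul_assoc, smul_mul_assoc, mul_sub, mul_one, mul_smul_comm, mul_assoc,
      (commute_Q_singAdd (p + 1)).eq, ← mul_assoc, pow_succ]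
  have e3 := congrArg sp e1
  have e4 := congrArg sp e2
  rw [map_sub, h.singSub_pow_mul_Q_mul_ab, h.singSub_pow_mul_Q_mul_ab, ← mul_sub, ← map_sub, e2,
    map_sum] at e3
  simpa only [map_add, map_sub, map_smul, smul_eq_mul] using e3

lemma moment_singAdd_of_ne_zero {p : ZMod n} (hp : p ≠ 0) (j : ℕ) :
    sp (singAdd n ν ^ j * Q n ν p) = sp (singSub n ν ^ j * Q n ν p) := by
  rw [singAdd_pow_mul_Q hp, singSub_pow_mul_Q hp]

/-- With `Q₀ = L₀²`, one factor `L₀` passes through the power, turning `𝔰 + iμL₀` into `-(𝔰 -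
iμL₀)`, and returns cyclically. -/
lemma IsKTrace.moment_singAdd_zero (h : IsKTrace κ sp) (j : ℕ) :
    sp (singAdd n ν ^ j * Q n ν 0) = (-1) ^ j * sp (singSub n ν ^ j * Q n ν 0) := by
  rw [← L_zero_mul_L_zero, ← mul_assoc, singAdd_pow_mul_L_zero, smul_mul_assoc, map_smul,
    smul_eq_mul, mul_assoc, h.mul_comm_even (by simp) (by simp), mul_assoc]

lemma IsKTrace.sp_sing_mul_L (h : IsKTrace κ sp) {w : H n ν} (hw : parityHom n ν w = w)
    (hc : Commute (sing n ν) w) : sp (sing n ν * w * L n ν 0) = 0 := by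
  have h1 : sp (sing n ν * w * L n ν 0) = -sp (sing n ν * w * L n ν 0) := by
    conv_lhs => rw [mul_assoc, h.mul_comm_even (by simp) (by simp [hw]), mul_assoc, L_mul_sing,
      mul_neg, ← mul_assoc, ← hc.eq, map_neg]
  linear_combination h1 / 2

/-- Against `L₀` the square is `𝔰² - μ²`, and the `𝔰²` part has zero trace, so each square
contributes `-μ²`. -/
lemma IsKTrace.sp_singSub_pow_mul_L (h : IsKTrace κ sp) (k : ℕ) :
    sp ((singSub n ν ^ 2) ^ k * L n ν 0) = (-((n : ℂ) * ν) ^ 2) ^ k * sp (L n ν 0) := by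
  induction k with
  | zero => simp
  | succ k ih =>
    have e : (singSub n ν ^ 2) ^ (k + 1) * L n ν 0 =
        sing n ν * (sing n ν * (singSub n ν ^ 2) ^ k) * L n ν 0 -
          ((n : ℂ) * ν) ^ 2 • ((singSub n ν ^ 2) ^ k * L n ν 0) := by
      rw [pow_succ, mul_assoc, ← commute_L_zero_singSub_sq.eq, singSub_sq, mul_sub,
        commute_L_zero_sing_sq.eq, mul_smul_comm, L_zero_mul_Q_zero, ← singSub_sq, mul_sub,
        mul_smul_comm, ← mul_assoc, ← ((commute_sing_singSub_sq.pow_right k).pow_left 2).eq,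
        sq (sing n ν)]
      simp only [mul_assoc]
    rw [e, map_sub, h.sp_sing_mul_L (by simp)
      ((Commute.refl _).mul_right (commute_sing_singSub_sq.pow_right k)), map_smul, ih,
      smul_eq_mul]
    ring

lemma IsKTrace.sp_sing_mul_Q (h : IsKTrace κ sp) {w : H n ν} (hw : parityHom n ν w = w)
    (hc : Commute (L n ν 0) w) : sp (sing n ν * w * Q n ν 0) = 0 := by
  have h1 : sp (sing n ν * w * Q n ν 0) = -sp (sing n ν * w * Q n ν 0) := by
    conv_lhs => rw [← L_zero_mul_L_zero, ← mul_assoc, h.mul_comm_even (by simp [hw]) (by simp),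
      ← mul_assoc, ← mul_assoc, L_mul_sing, neg_mul, mul_assoc _ (L n ν 0) w, hc.eq, neg_mul,
      map_neg, ← mul_assoc, mul_assoc _ (L n ν 0), L_zero_mul_L_zero]
  linear_combination h1 / 2

/-- Expanding a single factor as `𝔰 - iμL₀`, the `𝔰` part has zero trace and the rest reduces to `sp
L₀`. -/
lemma IsKTrace.moment_singSub_odd (h : IsKTrace κ sp) (k : ℕ) :
    sp (singSub n ν ^ (2 * k + 1) * Q n ν 0) =
      -(Complex.I * (n * ν)) ^ (2 * k + 1) * sp (L n ν 0) := by
  have e : singSub n ν ^ (2 * k + 1) * Q n ν 0 =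
      sing n ν * (singSub n ν ^ 2) ^ k * Q n ν 0 -
        (Complex.I * (n * ν)) • ((singSub n ν ^ 2) ^ k * L n ν 0) := by
    rw [pow_succ', pow_mul]
    conv_lhs => rw [singSub, sub_mul, ← singSub, sub_mul, smul_mul_assoc, smul_mul_assoc,
      (commute_L_zero_singSub_sq.pow_right k).eq, mul_assoc _ (L n ν 0), L_zero_mul_Q_zero]
  have hI : (Complex.I * (n * ν)) ^ 2 = -((n * ν) ^ 2) := by
    linear_combination ((n : ℂ) * ν) ^ 2 * Complex.I_mul_I
  rw [e, map_sub, h.sp_sing_mul_Q (by simp) (commute_L_zero_singSub_sq.pow_right k), map_smul,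
    h.sp_singSub_pow_mul_L, smul_eq_mul, pow_succ (Complex.I * _), pow_mul, hI]
  ring

/-- The trace of `L₋₁[a⁰, a¹] = μQ₁` is computed a second time by moving `b` cyclically after `L₋₁ a
= -b L₀`. -/
lemma IsKTrace.sp_L_zero (h : IsKTrace κ sp) :
    κ * sp (L n ν 0) = n * ν * (sp (Q n ν 1) - κ * sp (Q n ν 0)) := by
  have h1 := a_mul_a_sub n ν 0 1
  rw [eps_zero_one, one_smul] at h1
  have h2 : L n ν (-1) * (a n ν 0 * a n ν 1) - L n ν (-1) * (a n ν 1 * a n ν 0) =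
      ((n : ℂ) * ν) • Q n ν 1 := by
    rw [← mul_sub, h1, mul_smul_comm, L_mul_L, if_pos (by ring)]
  have h3 : ∀ α β : Fin 2, sp (L n ν (-1) * (a n ν α * a n ν β)) =
      -(κ * sp (L n ν 0 * (a n ν β * b n ν α))) := by
    intro α β
    rw [← mul_assoc, L_mul_a, neg_add_cancel, neg_mul, map_neg, mul_assoc,
      h.mul_comm_odd (by simp) (by simp), mul_assoc]
  have h4 : L n ν 0 * (a n ν 0 * b n ν 1) - L n ν 0 * (a n ν 1 * b n ν 0) =
      Complex.I • (L n ν 0 * sing n ν) + L n ν 0 + ((n : ℂ) * ν) • Q n ν 0 := by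
    have h5 : a n ν 0 * b n ν 1 - a n ν 1 * b n ν 0 =
        Complex.I • sing n ν + 1 + ((n : ℂ) * ν) • L n ν 0 := by
      rw [I_smul_sing_eq_ab]; abel
    rw [← mul_sub, h5, mul_add, mul_add, mul_one, mul_smul_comm, mul_smul_comm, L_zero_mul_L_zero]
  have h6 := h.sp_sing_mul_L (w := 1) (by simp) (Commute.one_right _)
  have h7 := congrArg sp h2
  have h8 := congrArg sp h4
  rw [L_mul_sing] at h8
  rw [mul_one] at h6
  simp only [map_sub, map_add, map_smul, map_neg, h3, h6, smul_eq_mul] at h7 h8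
  linear_combination h7 - κ * h8

lemma IsKTrace.sp_S_neg (h : IsKTrace κ sp) (k : ZMod n) : sp (S n ν (-k)) = sp (S n ν k) := by
  have e1 : S n ν (-k) = R n ν 0 * (S n ν k * R n ν 0) := by
    rw [S_mul_R, R_mul_R]; simp
  rw [e1, h.mul_comm_even (by simp) (by simp), mul_assoc, R_mul_R, sub_self, S_zero, mul_one]

lemma S_eq_sum (k : ZMod n) : S n ν k = ∑ p : ZMod n, lamPow n (k * p) • Q n ν p := by
  have hn : (n : ℂ) ≠ 0 := Nat.cast_ne_zero.2 (NeZero.ne n)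
  simp only [Q, Finset.smul_sum, smul_smul]
  rw [Finset.sum_comm]
  have h : ∀ l p : ZMod n, lamPow n (k * p) * (1 / (n : ℂ) * lamPow n (-(l * p))) =
      1 / (n : ℂ) * lamPow n (p * (k - l)) := by
    intro l p
    rw [mul_left_comm, ← lamPow_add]
    congr 2; ring
  simp only [h, ← Finset.sum_smul, ← Finset.mul_sum, sum_lamPow_mul, sub_eq_zero]
  rw [Finset.sum_eq_single k (fun l _ hl => by simp [Ne.symm hl]) (by simp)]
  simp [hn]

end moments

/-! ### Uniqueness for the moment recursion -/

section uniqueness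

variable {n : ℕ}

lemma eq_pow_mul_of_eq_mul_succ {κ : ℂ} {f : ZMod n → ℂ} (h : ∀ p, f p = κ * f (p + 1)) (k : ℕ)
    (p : ZMod n) : f p = κ ^ k * f (p + k) := by
  induction k with
  | zero => simp
  | succ k ih => rw [ih, h (p + k), pow_succ, mul_assoc, Nat.cast_succ, add_assoc]

lemma moment_recursion_unique [NeZero n] (hn : Odd n) {κ : ℂ} (hκ : κ = 1 ∨ κ = -1) {D : ZMod n → ℕ → ℂ}
    (hrec : ∀ p j, Complex.I * D p (j + 1) + D p j =
      κ * ∑ m ∈ Finset.range (j + 1), (j.choose m : ℂ) * Complex.I ^ (j - m) *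
        (Complex.I * D (p + 1) (m + 1) - D (p + 1) m))
    (h0 : ∀ p, D p 0 = κ * D (p + 1) 0) (j : ℕ) (p : ZMod n) : D p j = 0 := by
  induction j using Nat.strong_induction_on generalizing p with
  | _ j ih =>
  -- With all lower orders zero, only the top term of the recursion one order below survives.
  have hstep : ∀ p, D p j = κ * D (p + 1) j := by
    intro p
    rcases j with _ | j
    · exact h0 p
    · have h := hrec p j
      rw [ih j (by omega), Finset.sum_range_succ, Finset.sum_eq_zero, ih j (by omega)] at h
      · have hI := Complex.I_ne_zero
        apply mul_left_cancel₀ hI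
        simp at h
        linear_combination h
      · intro m hm
        rw [Finset.mem_range] at hm
        rw [ih (m + 1) (by omega), ih m (by omega)]
        simp
  rcases hκ with rfl | rfl
  · have hconst : ∀ q, D q j = D 0 j := by
      intro q
      have h := eq_pow_mul_of_eq_mul_succ (f := fun p => D p j) hstep q.val 0
      simpa using h.symm
    -- For `κ = 1`, `hstep` gives only constancy in `p`. The recursion at order `j` retains the
    -- terms `m = j` and `m = j - 1`; summed over `p`, the unknown order `j + 1` cancels, leaving
    -- `(j + 2) n D = 0`.
    have hsum : ∀ p, Complex.I * D p (j + 1) + D p j =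
        Complex.I * D (p + 1) (j + 1) - D (p + 1) j - j * D (p + 1) j := by
      intro p
      rw [hrec p j]
      rcases j with _ | j
      · simp
      · rw [Finset.sum_range_succ, Finset.sum_range_succ, Finset.sum_eq_zero,
          ih j (by omega)]
        · rw [show j + 1 - j = 1 by omega]
          simp
          linear_combination ((j : ℂ) + 1) * D (p + 1) (j + 1) * Complex.I_mul_I
        · intro m hm
          rw [Finset.mem_range] at hm
          rw [ih (m + 1) (by omega), ih m (by omega)]
          simp
    have htot := Finset.sum_congr (s₁ := (Finset.univ : Finset (ZMod n))) rfl
      fun p _ => hsum p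
    have hsh : ∀ i, ∑ p : ZMod n, D (p + 1) i = ∑ p : ZMod n, D p i := fun i =>
      Equiv.sum_comp (Equiv.addRight (1 : ZMod n)) fun p => D p i
    simp only [Finset.sum_add_distrib, Finset.sum_sub_distrib, ← Finset.mul_sum, hsh] at htot
    simp only [hconst, Finset.sum_const, Finset.card_univ, ZMod.card, nsmul_eq_mul] at htot
    have hmul : ((j : ℂ) + 2) * n * D 0 j = 0 := by linear_combination htot
    have hj : (j : ℂ) + 2 ≠ 0 := by exact_mod_cast Nat.succ_ne_zero (j + 1)
    have hn0 : (n : ℂ) ≠ 0 := Nat.cast_ne_zero.2 (NeZero.ne n)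
    rw [hconst p]
    simpa [hj, hn0] using hmul
  -- For `κ = -1`, a full turn of odd length `n` gives `D = -D`.
  · have h := eq_pow_mul_of_eq_mul_succ (f := fun p => D p j) hstep n p
    simp only [hn.neg_one_pow, ZMod.natCast_self, add_zero] at h
    linear_combination h / 2

end uniqueness

/-! ### The explicit solution: point evaluations and the Fejér kernel -/

section model

variable {n : ℕ}

/-- `∑ κ^r g (μ - r)` over the `0 ≤ r < μ` congruent to `p` modulo `n`. -/
noncomputable def residueSum (κ : ℂ) (μ : ℕ) (p : ZMod n) (g : ℂ → ℂ) : ℂ :=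
  ∑ r ∈ Finset.range μ, if (r : ZMod n) = p then κ ^ r * g ((μ : ℂ) - r) else 0

/-- The substitution `r ↦ r + 1`. The boundary term at `r = 0` stays as a correction; the one at the
other end carries `g 0` and is removed by `hg`. -/
lemma mul_residueSum_add_one {κ : ℂ} (hκ : κ * κ = 1) {μ : ℕ} (hμ : 0 < μ) (p : ZMod n)
    (g : ℂ → ℂ) (hg : g 0 = 0 ∨ (μ : ZMod n) ≠ p + 1) :
    κ * residueSum κ μ (p + 1) g = residueSum κ μ p (fun l => g (l - 1)) +
      if p + 1 = 0 then κ * g μ else 0 := by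
  obtain ⟨u, rfl⟩ : ∃ u, μ = u + 1 := ⟨μ - 1, by omega⟩
  rw [residueSum, residueSum, Finset.sum_range_succ', Finset.sum_range_succ, mul_add,
    Finset.mul_sum]
  have hlast : (if (u : ZMod n) = p then κ ^ u * g (((u + 1 : ℕ) : ℂ) - u - 1) else 0) = 0 := by
    split_ifs with hu
    · rcases hg with hg | hg
      · rw [show ((u + 1 : ℕ) : ℂ) - u - 1 = 0 by push_cast; ring, hg, mul_zero]
      · exact absurd (by rw [← hu]; push_cast; rfl) hg
    · rfl
  rw [hlast, add_zero]
  congr 1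
  · refine Finset.sum_congr rfl fun r _ => ?_
    rw [mul_ite, mul_zero]
    refine if_congr (by rw [Nat.cast_succ]; exact add_left_inj 1) ?_ rfl
    rw [show ((u + 1 : ℕ) : ℂ) - ((r + 1 : ℕ) : ℂ) = ((u + 1 : ℕ) : ℂ) - r - 1 by push_cast; ring,
      pow_succ]
    linear_combination κ ^ r * g (((u + 1 : ℕ) : ℂ) - r - 1) * hκ
  · simp [eq_comm]

/-- The moment functionals of the degenerate `κ`-trace (normalised), as finite combinations of
point evaluations. -/
noncomputable def model (κ : ℂ) (μ : ℕ) (p : ZMod n) : (ℂ → ℂ) →ₗ[ℂ] ℂ where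
  toFun φ := residueSum κ μ p (fun l => l * φ l) + residueSum κ μ (-p) (fun l => l * φ (-l)) -
    if p = 0 then μ * φ (-μ) else 0
  map_add' φ ψ := by
    simp only [residueSum, Pi.add_apply, mul_add, Finset.sum_add_distrib, ite_add_zero]
    ring
  map_smul' c φ := by
    simp only [residueSum, Pi.smul_apply, smul_eq_mul, RingHom.id_apply, mul_sub, mul_add,
      Finset.mul_sum, mul_ite, mul_zero]
    congr 1
    · congr 1 <;> exact Finset.sum_congr rfl fun r _ => by congr 1; ring
    · congr 1; ring

lemma model_apply (κ : ℂ) (μ : ℕ) (p : ZMod n) (φ : ℂ → ℂ) : model κ μ p φ =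
    residueSum κ μ p (fun l => l * φ l) + residueSum κ μ (-p) (fun l => l * φ (-l)) -
      if p = 0 then μ * φ (-μ) else 0 := rfl

/-- The same functionals with the extra point evaluation at `-μ` in place of `μ`. -/
noncomputable def model' (κ : ℂ) (μ : ℕ) (p : ZMod n) : (ℂ → ℂ) →ₗ[ℂ] ℂ :=
  model κ μ p + if p = 0 then (μ : ℂ) • (LinearMap.proj (R := ℂ) (φ := fun _ : ℂ => ℂ) (-μ : ℂ) -
    LinearMap.proj (R := ℂ) (φ := fun _ : ℂ => ℂ) (μ : ℂ)) else 0

lemma model'_apply (κ : ℂ) (μ : ℕ) (p : ZMod n) (φ : ℂ → ℂ) : model' κ μ p φ =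
    residueSum κ μ p (fun l => l * φ l) + residueSum κ μ (-p) (fun l => l * φ (-l)) -
      if p = 0 then μ * φ μ else 0 := by
  rw [model', LinearMap.add_apply, model_apply]
  split_ifs
  · simp; ring
  · simp

/-- The corrections at `∓μ` in `model` and `model'` are precisely the boundary terms of the two
shifts. The weight `l` kills the other boundary. -/
lemma model_shift {κ : ℂ} (hκ : κ * κ = 1) {μ : ℕ} (hμ : 0 < μ) (p : ZMod n) (φ : ℂ → ℂ) :
    model κ μ p (fun l => (1 - l) * φ l) =
      κ * model' κ μ (p + 1) (fun l => (-l - 1) * φ (l + 1)) := by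
  have h1 := mul_residueSum_add_one hκ hμ p (fun l => l * ((-l - 1) * φ (l + 1))) (by simp)
  have h2 := mul_residueSum_add_one hκ hμ (-(p + 1)) (fun l => l * ((1 + l) * φ (-l)))
    (by simp)
  rw [show -(p + 1) + 1 = -p by ring] at h2
  have e1 : (fun l : ℂ => (l - 1) * ((-(l - 1) - 1) * φ (l - 1 + 1))) =
      fun l => l * ((1 - l) * φ l) := by
    funext l; rw [sub_add_cancel]; ring
  have e2 : (fun l : ℂ => (l - 1) * ((1 + (l - 1)) * φ (-(l - 1)))) =
      fun l => l * ((- -l - 1) * φ (-l + 1)) := by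
    funext l; rw [show -(l - 1) = -l + 1 by ring]; ring
  simp only [e1] at h1
  simp only [e2, neg_eq_zero] at h2
  rw [model_apply, model'_apply, mul_sub, mul_add, h1]
  simp only [sub_neg_eq_add]
  have h3 : κ * residueSum κ μ (-(p + 1)) (fun l => l * ((- -l - 1) * φ (-l + 1))) =
      residueSum κ μ (-p) (fun l => l * ((1 + l) * φ (-l))) -
        if p = 0 then μ * ((1 + μ) * φ (-μ)) else 0 := by
    have h4 : (if p = 0 then κ * (μ * ((1 + μ) * φ (-μ))) else 0) =
        κ * if p = 0 then μ * ((1 + μ) * φ (-μ)) else 0 := by rw [mul_ite, mul_zero]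
    rw [h4] at h2
    linear_combination -κ * h2 + (residueSum κ μ (-p) (fun l => l * ((1 + l) * φ (-l))) -
      if p = 0 then μ * ((1 + μ) * φ (-μ)) else 0) * hκ
  rw [h3]
  split_ifs <;> ring

/-- The moments of `model` satisfy the recursion of `IsKTrace.moment_recursion`. -/
lemma model_moment_recursion {κ : ℂ} (hκ : κ * κ = 1) {μ : ℕ} (hμ : 0 < μ) (p : ZMod n) (j : ℕ) :
    Complex.I * model κ μ p (fun l => (Complex.I * l) ^ (j + 1)) +
        model κ μ p (fun l => (Complex.I * l) ^ j) =
      κ * ∑ m ∈ Finset.range (j + 1), (j.choose m : ℂ) * Complex.I ^ (j - m) *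
        (Complex.I * model' κ μ (p + 1) (fun l => (Complex.I * l) ^ (m + 1)) -
          model' κ μ (p + 1) (fun l => (Complex.I * l) ^ m)) := by
  have e1 : (fun l : ℂ => (1 - l) * (Complex.I * l) ^ j) =
      Complex.I • (fun l : ℂ => (Complex.I * l) ^ (j + 1)) + fun l : ℂ => (Complex.I * l) ^ j := by
    funext l
    simp only [Pi.add_apply, Pi.smul_apply, smul_eq_mul, pow_succ]
    linear_combination -l * (Complex.I * l) ^ j * Complex.I_mul_I
  have e2 : (fun l : ℂ => (-l - 1) * (Complex.I * (l + 1)) ^ j) =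
      ∑ m ∈ Finset.range (j + 1), ((j.choose m : ℂ) * Complex.I ^ (j - m)) •
        (Complex.I • (fun l : ℂ => (Complex.I * l) ^ (m + 1)) -
          fun l : ℂ => (Complex.I * l) ^ m) := by
    funext l
    simp only [Finset.sum_apply, Pi.smul_apply, Pi.sub_apply, smul_eq_mul]
    rw [mul_add, mul_one, add_pow, Finset.mul_sum]
    refine Finset.sum_congr rfl fun m _ => ?_
    rw [pow_succ]
    linear_combination (-(j.choose m : ℂ) * Complex.I ^ (j - m) * l * (Complex.I * l) ^ m) *
      Complex.I_mul_I
  have h := model_shift hκ hμ p fun l => (Complex.I * l) ^ j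
  rw [e1, e2, map_sum] at h
  simpa only [map_add, map_sub, map_smul, smul_eq_mul] using h

/-- Supplies the value of `sp L₀` through `IsKTrace.sp_L_zero`. The shifted weight `l + 1` does not
vanish at `0`, so the boundary term disappears only because `n ∤ μ`. -/
lemma model_one_sub {κ : ℂ} (hκ : κ * κ = 1) {μ : ℕ} (hμ : 0 < μ) (hdvd : ¬ n ∣ μ) :
    κ * model κ μ (1 : ZMod n) (fun _ => 1) - model κ μ (0 : ZMod n) (fun _ => 1) = -1 := by
  have hμ0 : (μ : ZMod n) ≠ 0 := fun h => hdvd ((ZMod.natCast_eq_zero_iff μ n).1 h)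
  have h10 : (1 : ZMod n) ≠ 0 := by
    intro h
    apply hμ0
    rw [← mul_one (μ : ZMod n), h, mul_zero]
  have h1 := mul_residueSum_add_one hκ hμ (0 : ZMod n) (fun l => l) (by simp)
  have h2 := mul_residueSum_add_one hκ hμ (-1 : ZMod n) (fun l => l + 1) (by right; simpa using hμ0)
  have h3 : residueSum κ μ (0 : ZMod n) (fun l => l - 1) +
      residueSum κ μ (0 : ZMod n) (fun l => l + 1) =
        2 * residueSum κ μ (0 : ZMod n) (fun l => l) := by
    simp only [residueSum]
    rw [← Finset.sum_add_distrib, Finset.mul_sum]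
    refine Finset.sum_congr rfl fun r _ => ?_
    split_ifs <;> ring
  simp only [zero_add, h10, if_false, neg_add_cancel, if_true, sub_add_cancel] at h1 h2
  rw [model_apply, model_apply, if_neg h10, if_pos rfl]
  simp only [mul_one, neg_zero]
  linear_combination h1 + h3 - κ * h2 +
    (residueSum κ μ (0 : ZMod n) (fun l => l + 1) - μ - 1) * hκ

lemma sum_mul_residueSum [NeZero n] (κ : ℂ) (μ : ℕ) (f : ZMod n → ℂ) (g : ℂ → ℂ) :
    ∑ p, f p * residueSum κ μ p g = ∑ r ∈ Finset.range μ, f r * (κ ^ r * g (μ - r)) := by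
  simp only [residueSum, Finset.mul_sum, mul_ite, mul_zero]
  rw [Finset.sum_comm]
  refine Finset.sum_congr rfl fun r _ => ?_
  simp

lemma lamPow_mul_natCast [NeZero n] (k : ZMod n) (r : ℕ) : lamPow n (k * r) = lamPow n k ^ r := by
  rw [mul_comm, ← nsmul_eq_mul]
  exact AddChar.map_nsmul_eq_pow _ _ _

lemma lamPow_mul_lamPow_neg [NeZero n] (k : ZMod n) : lamPow n k * lamPow n (-k) = 1 := by
  rw [← lamPow_add, add_neg_cancel, lamPow_zero]

lemma sum_lamPow_mul_model [NeZero n] (κ : ℂ) (μ : ℕ) (k : ZMod n) :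
    ∑ p, lamPow n (k * p) * model κ μ p (fun _ => 1) =
      ∑ r ∈ Finset.range μ, ((μ : ℂ) - r) * (κ * lamPow n k) ^ r +
        ∑ r ∈ Finset.range μ, ((μ : ℂ) - r) * (κ * lamPow n (-k)) ^ r - μ := by
  simp only [model_apply, mul_sub, mul_add, Finset.sum_sub_distrib, Finset.sum_add_distrib,
    mul_one, mul_ite, mul_zero]
  congr 1
  · congr 1
    · rw [sum_mul_residueSum κ μ (fun p => lamPow n (k * p))]
      refine Finset.sum_congr rfl fun r _ => ?_
      rw [lamPow_mul_natCast, mul_pow]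
      ring
    · rw [← Equiv.sum_comp (Equiv.neg (ZMod n))]
      simp only [Equiv.neg_apply, neg_neg]
      rw [sum_mul_residueSum κ μ (fun p => lamPow n (k * -p))]
      refine Finset.sum_congr rfl fun r _ => ?_
      rw [mul_neg, ← neg_mul, lamPow_mul_natCast, mul_pow]
      ring
  · simp

lemma mul_sum_range_sub_mul_pow {z w : ℂ} (h : z * w = 1) (μ : ℕ) :
    (2 - z - w) * ∑ r ∈ Finset.range μ, ((μ : ℂ) - r) * z ^ r = μ * (1 - w) + 1 - z ^ μ := by
  induction μ with
  | zero => simp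
  | succ μ ih =>
    have e : ∑ r ∈ Finset.range (μ + 1), (((μ + 1 : ℕ) : ℂ) - r) * z ^ r =
        ∑ r ∈ Finset.range μ, ((μ : ℂ) - r) * z ^ r + ∑ r ∈ Finset.range (μ + 1), z ^ r := by
      rw [Finset.sum_range_succ _ μ, Finset.sum_range_succ (fun r => z ^ r) μ, ← add_assoc,
        ← Finset.sum_add_distrib]
      congr 1
      · exact Finset.sum_congr rfl fun r _ => by push_cast; ring
      · push_cast; ring
    have hg := mul_neg_geom_sum z (μ + 1)
    rw [e, mul_add, ih]
    push_cast
    linear_combination (1 - w) * hg + (z ^ μ - ∑ r ∈ Finset.range (μ + 1), z ^ r) * h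

/-- The Fejér kernel. -/
lemma mul_fejer {z w : ℂ} (h : z * w = 1) (μ : ℕ) :
    (2 - z - w) * (∑ r ∈ Finset.range μ, ((μ : ℂ) - r) * z ^ r +
      ∑ r ∈ Finset.range μ, ((μ : ℂ) - r) * w ^ r - μ) = 2 - z ^ μ - w ^ μ := by
  have h1 := mul_sum_range_sub_mul_pow h μ
  have h2 := mul_sum_range_sub_mul_pow (mul_comm z w ▸ h) μ
  linear_combination h1 + h2

lemma fourier_inversion [NeZero n] (f : ZMod n → ℂ) (p : ZMod n) :
    ∑ k : ZMod n, lamPow n (-(k * p)) * ∑ q, lamPow n (k * q) * f q = n * f p := by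
  simp only [Finset.mul_sum]
  rw [Finset.sum_comm]
  have h : ∀ q k : ZMod n, lamPow n (-(k * p)) * (lamPow n (k * q) * f q) =
      lamPow n (k * (q - p)) * f q := by
    intro q k
    rw [← mul_assoc, ← lamPow_add]
    congr 2; ring
  simp only [h, ← Finset.sum_mul, sum_lamPow_mul, sub_eq_zero, ite_mul, zero_mul]
  simp

end model

/-! ### Matching the prescribed values on rotations with the model -/

section values

variable {n : ℕ} [NeZero n] {ν κ τ : ℂ} {sp : H n ν →ₗ[ℂ] ℂ} {μ : ℕ}

lemma lamPow_natCast (k : ℕ) :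
    lamPow n (k : ZMod n) = Complex.exp ((2 * Real.pi * k / n : ℝ) * Complex.I) := by
  have h := ZMod.stdAddChar_coe (N := n) (k : ℤ)
  rw [Int.cast_natCast] at h
  rw [lamPow, h]
  congr 1
  push_cast
  ring

lemma lamPow_neg_natCast (k : ℕ) :
    lamPow n (-(k : ZMod n)) = Complex.exp (-((2 * Real.pi * k / n : ℝ) * Complex.I)) := by
  rw [Complex.exp_neg, ← lamPow_natCast]
  exact eq_inv_of_mul_eq_one_right (lamPow_mul_lamPow_neg _)

lemma lamPow_natCast_add_neg (k : ℕ) :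
    lamPow n (k : ZMod n) + lamPow n (-(k : ZMod n)) = 2 * (Real.cos (2 * Real.pi * k / n) : ℂ) := by
  rw [lamPow_natCast, lamPow_neg_natCast, Complex.ofReal_cos, Complex.cos, neg_mul]
  ring

lemma lamPow_natCast_pow_add_neg (k μ : ℕ) :
    lamPow n (k : ZMod n) ^ μ + lamPow n (-(k : ZMod n)) ^ μ =
      2 * (Real.cos (2 * Real.pi * k * μ / n) : ℂ) := by
  rw [lamPow_natCast, lamPow_neg_natCast, Complex.ofReal_cos, Complex.cos, neg_mul,
    ← Complex.exp_nat_mul, ← Complex.exp_nat_mul, mul_div_cancel₀ _ (two_ne_zero' ℂ)]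
  congr 2 <;> push_cast <;> ring

lemma IsSpZ.exists_sp_S_natCast (hκ : κ = 1 ∨ κ = -1) (h : IsSpZ κ (μ : ℤ) τ sp) {k : ℕ}
    (hk : 2 * k < n) (hk1 : κ = 1 → 1 ≤ k) :
    ∃ X : ℂ, X ≠ 0 ∧ 2 * X = 1 - κ * (Real.cos (2 * Real.pi * k / n) : ℂ) ∧
      sp (S n ν (k : ZMod n)) =
        τ / (n * X) * (1 - κ ^ μ * (Real.cos (2 * Real.pi * k * μ / n) : ℂ)) := by
  have hn : (0 : ℝ) < n := Nat.cast_pos.2 (NeZero.pos n)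
  have hk' : (2 : ℝ) * k < n := by exact_mod_cast hk
  have hlt : Real.pi * k / n < Real.pi / 2 := by
    rw [div_lt_div_iff₀ hn two_pos]
    nlinarith [Real.pi_pos]
  have hθ : 2 * Real.pi * k / n = 2 * (Real.pi * k / n) := by ring
  rcases hκ with rfl | rfl
  · have hk0 : (0 : ℝ) < k := by exact_mod_cast hk1 rfl
    refine ⟨(Real.sin (Real.pi * k / n) : ℂ) ^ 2, ?_, ?_, ?_⟩
    · have hpos : 0 < Real.sin (Real.pi * k / n) :=
        Real.sin_pos_of_pos_of_lt_pi (by positivity) (by linarith [Real.pi_pos])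
      exact pow_ne_zero _ (Complex.ofReal_ne_zero.2 hpos.ne')
    · rw [hθ, Real.cos_two_mul, Real.cos_sq']
      push_cast
      ring
    · have hv := h.trace_values rfl k (hk1 rfl) hk
      rw [Int.cast_natCast] at hv
      rw [hv, one_pow, one_mul]
  · refine ⟨(Real.cos (Real.pi * k / n) : ℂ) ^ 2, ?_, ?_, ?_⟩
    · have hpos : 0 < Real.cos (Real.pi * k / n) :=
        Real.cos_pos_of_mem_Ioo ⟨lt_of_lt_of_le (by linarith [Real.pi_pos])
          (show (0 : ℝ) ≤ Real.pi * k / n by positivity), hlt⟩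
      exact pow_ne_zero _ (Complex.ofReal_ne_zero.2 hpos.ne')
    · rw [hθ, Real.cos_two_mul]
      push_cast
      ring
    · have hv := h.supertrace_values rfl k hk
      rw [Int.cast_natCast, zpow_natCast] at hv
      exact hv

lemma IsSpZ.sp_S_natCast (hκ : κ = 1 ∨ κ = -1) (h : IsSpZ κ (μ : ℤ) τ sp) {k : ℕ}
    (hk : 2 * k < n) (hk1 : κ = 1 → 1 ≤ k) :
    sp (S n ν (k : ZMod n)) =
      2 * τ / n * ∑ p, lamPow n ((k : ZMod n) * p) * model κ μ p (fun _ => 1) := by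
  obtain ⟨X, hX, hcos, hv⟩ := h.exists_sp_S_natCast hκ hk hk1
  have hκ2 : κ * κ = 1 := by rcases hκ with rfl | rfl <;> norm_num
  have hn : (n : ℂ) ≠ 0 := Nat.cast_ne_zero.2 (NeZero.ne n)
  have hzw : κ * lamPow n (k : ZMod n) * (κ * lamPow n (-(k : ZMod n))) = 1 := by
    rw [mul_mul_mul_comm, hκ2, lamPow_mul_lamPow_neg, one_mul]
  have hf := mul_fejer hzw μ
  have h1 := lamPow_natCast_add_neg (n := n) k
  have h2 := lamPow_natCast_pow_add_neg (n := n) k μ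
  rw [← sum_lamPow_mul_model, mul_pow, mul_pow] at hf
  rw [hv]
  have hf' : 2 * X * ∑ p, lamPow n ((k : ZMod n) * p) * model κ μ p (fun _ => 1) =
      1 - κ ^ μ * (Real.cos (2 * Real.pi * k * μ / n) : ℂ) := by
    rw [hcos]
    linear_combination hf / 2 +
      κ / 2 * (∑ p, lamPow n ((k : ZMod n) * p) * model κ μ p (fun _ => 1)) * h1 - κ ^ μ / 2 * h2
  rw [← hf']
  field_simp

lemma sum_lamPow_neg_mul_model (κ : ℂ) (μ : ℕ) (k : ZMod n) :
    ∑ p, lamPow n (-k * p) * model κ μ p (fun _ => 1) =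
      ∑ p, lamPow n (k * p) * model κ μ p (fun _ => 1) := by
  rw [sum_lamPow_mul_model, sum_lamPow_mul_model, neg_neg]
  ring

lemma IsSpZ.sp_S (hn : Odd n) (hκ : κ = 1 ∨ κ = -1) (h : IsSpZ κ (μ : ℤ) τ sp) (k : ZMod n)
    (hk : κ = 1 → k ≠ 0) :
    sp (S n ν k) = 2 * τ / n * ∑ p, lamPow n (k * p) * model κ μ p (fun _ => 1) := by
  have hlt := ZMod.val_lt k
  have hval : ((k.val : ℕ) : ZMod n) = k := ZMod.natCast_zmod_val k
  rcases lt_or_ge (2 * k.val) n with h2 | h2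
  · have h1 := h.sp_S_natCast hκ h2 fun e => by
      have := (ZMod.val_ne_zero k).2 (hk e)
      omega
    rwa [hval] at h1
  · obtain ⟨m, rfl⟩ := hn
    -- Values are prescribed for half of the rotations; both sides are even in `k`, which covers the
    -- rest.
    have h1 := h.sp_S_natCast (k := 2 * m + 1 - k.val) hκ (by omega) fun _ => by omega
    rw [Nat.cast_sub hlt.le, ZMod.natCast_self, hval, zero_sub, h.isKTrace.sp_S_neg,
      sum_lamPow_neg_mul_model] at h1
    exact h1

/-- For `κ = 1` the value at `S₀` is not prescribed, so Fourier inversion determines the traces of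
the `Q_p` only up to a constant independent of `p`. For `κ = -1` the defect is zero. -/
lemma IsSpZ.defect_zero (hn : Odd n) (hκ : κ = 1 ∨ κ = -1) (h : IsSpZ κ (μ : ℤ) τ sp)
    (p : ZMod n) :
    sp (Q n ν p) - 2 * τ / n * model κ μ p (fun _ => 1) =
      κ * (sp (Q n ν (p + 1)) - 2 * τ / n * model κ μ (p + 1) (fun _ => 1)) := by
  have hn0 : (n : ℂ) ≠ 0 := Nat.cast_ne_zero.2 (NeZero.ne n)
  set D : ZMod n → ℂ := fun p => sp (Q n ν p) - 2 * τ / n * model κ μ p (fun _ => 1) with hD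
  have hF : ∀ k, ∑ q, lamPow n (k * q) * D q = sp (S n ν k) -
      2 * τ / n * ∑ p, lamPow n (k * p) * model κ μ p (fun _ => 1) := by
    intro k
    rw [S_eq_sum, map_sum, Finset.mul_sum, ← Finset.sum_sub_distrib]
    refine Finset.sum_congr rfl fun q _ => ?_
    rw [map_smul, smul_eq_mul, hD]
    ring
  have hinv := fun p => fourier_inversion D p
  change D p = κ * D (p + 1)
  rcases hκ with rfl | rfl
  · have hconst : ∀ p, n * D p = ∑ q, D q := by
      intro p
      rw [← hinv p, Finset.sum_eq_single 0]
      · simp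
      · intro k _ hk
        rw [hF, h.sp_S hn (Or.inl rfl) k fun _ => hk, sub_self, mul_zero]
      · simp
    have := (hconst p).trans (hconst (p + 1)).symm
    rw [one_mul]
    exact mul_left_cancel₀ hn0 this
  · have hz : ∀ p, D p = 0 := by
      intro p
      have h1 := hinv p
      rw [Finset.sum_eq_zero fun k _ => ?_] at h1
      · simpa [hn0] using h1.symm
      · rw [hF, h.sp_S hn (Or.inr rfl) k fun e => absurd e (by norm_num), sub_self, mul_zero]
    rw [hz, hz, mul_zero]

variable (hn : Odd n) (hμ : 0 < μ) (hdvd : ¬ n ∣ μ) (hν : (n : ℂ) * ν = (μ : ℂ))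

include hn hμ hdvd hν

lemma IsSpZ.sp_L_zero (hκ : κ = 1 ∨ κ = -1) (h : IsSpZ κ (μ : ℤ) τ sp) :
    sp (L n ν 0) = -(2 * τ / n * μ) := by
  have hκ2 : κ * κ = 1 := by rcases hκ with rfl | rfl <;> norm_num
  have h1 := h.defect_zero hn hκ 0
  have h2 := model_one_sub (n := n) hκ2 hμ hdvd
  have h3 := h.isKTrace.sp_L_zero
  rw [hν] at h3
  rw [zero_add] at h1
  linear_combination κ * h3 - μ * h1 + 2 * τ / n * μ * h2 -
    (sp (L n ν 0) + μ * sp (Q n ν 0)) * hκ2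

theorem IsSpZ.moment_eq (hκ : κ = 1 ∨ κ = -1) (h : IsSpZ κ (μ : ℤ) τ sp) (p : ZMod n) (j : ℕ) :
    sp (singSub n ν ^ j * Q n ν p) = 2 * τ / n * model κ μ p (fun l => (Complex.I * l) ^ j) := by
  have hκ2 : κ * κ = 1 := by rcases hκ with rfl | rfl <;> norm_num
  have hs := h.sp_L_zero hn hμ hdvd hν hκ
  -- The defects for the two signs coincide, so the difference of solutions obeys a closed
  -- recursion. The only nontrivial case is `p = 0`, `j` odd, where the known value of `sp L₀`
  -- enters.
  have hdefect : ∀ p j, sp (singAdd n ν ^ j * Q n ν p) -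
      2 * τ / n * model' κ μ p (fun l => (Complex.I * l) ^ j) =
      sp (singSub n ν ^ j * Q n ν p) -
        2 * τ / n * model κ μ p (fun l => (Complex.I * l) ^ j) := by
    intro p j
    by_cases hp : p = 0
    · subst hp
      rw [h.isKTrace.moment_singAdd_zero, model'_apply, model_apply, if_pos rfl, if_pos rfl,
        mul_neg]
      rcases Nat.even_or_odd j with hj | hj
      · rw [hj.neg_one_pow, hj.neg_pow]
        ring
      · rw [hj.neg_one_pow, hj.neg_pow]
        obtain ⟨k, rfl⟩ := hj
        have hodd := h.isKTrace.moment_singSub_odd k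
        rw [hν, hs] at hodd
        linear_combination -2 * hodd
    · rw [moment_singAdd_of_ne_zero hp, model'_apply, model_apply, if_neg hp, if_neg hp]
  rw [← sub_eq_zero]
  refine moment_recursion_unique hn hκ (D := fun p j => sp (singSub n ν ^ j * Q n ν p) -
    2 * τ / n * model κ μ p (fun l => (Complex.I * l) ^ j)) ?_ ?_ j p
  · intro p j
    have h1 := h.isKTrace.moment_recursion p j
    have h2 := model_moment_recursion hκ2 hμ p j
    simp only [← hdefect (p + 1)]
    have h3 : ∑ m ∈ Finset.range (j + 1), (j.choose m : ℂ) * Complex.I ^ (j - m) *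
        (Complex.I * (sp (singAdd n ν ^ (m + 1) * Q n ν (p + 1)) -
          2 * τ / n * model' κ μ (p + 1) (fun l => (Complex.I * l) ^ (m + 1))) -
        (sp (singAdd n ν ^ m * Q n ν (p + 1)) -
          2 * τ / n * model' κ μ (p + 1) (fun l => (Complex.I * l) ^ m))) =
        ∑ m ∈ Finset.range (j + 1), (j.choose m : ℂ) * Complex.I ^ (j - m) *
          (Complex.I * sp (singAdd n ν ^ (m + 1) * Q n ν (p + 1)) -
            sp (singAdd n ν ^ m * Q n ν (p + 1))) -
        2 * τ / n * ∑ m ∈ Finset.range (j + 1), (j.choose m : ℂ) * Complex.I ^ (j - m) *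
          (Complex.I * model' κ μ (p + 1) (fun l => (Complex.I * l) ^ (m + 1)) -
            model' κ μ (p + 1) (fun l => (Complex.I * l) ^ m)) := by
      rw [Finset.mul_sum, ← Finset.sum_sub_distrib]
      exact Finset.sum_congr rfl fun m _ => by ring
    rw [h3]
    linear_combination h1 - 2 * τ / n * h2
  · intro p
    simpa using h.defect_zero hn hκ p

end values

/-! ### Laurent coefficients from the model at `p = 0` -/

section laurent

variable {n : ℕ} {κ τ : ℂ} {μ : ℕ}

/-- The Laurent coefficients of `F₀`. -/
noncomputable def laurentCoeff (n μ : ℕ) (τ : ℂ) (l : ℤ) : ℂ :=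
  if (l.natAbs : ZMod n) = μ ∧ l ≠ -μ then 2 * τ / n * l.natAbs else 0

lemma sum_Icc_neg_natCast (g : ℤ → ℂ) (μ : ℕ) : ∑ l ∈ Finset.Icc (-(μ : ℤ)) μ, g l =
    g 0 + ∑ l ∈ Finset.Ico 1 (μ + 1), (g l + g (-l)) := by
  induction μ with
  | zero => simp
  | succ μ ih =>
    have e : Finset.Icc (-((μ + 1 : ℕ) : ℤ)) ((μ + 1 : ℕ) : ℤ) =
        insert ((μ + 1 : ℕ) : ℤ) (insert (-((μ + 1 : ℕ) : ℤ)) (Finset.Icc (-(μ : ℤ)) μ)) := by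
      ext x
      simp only [Finset.mem_Icc, Finset.mem_insert]
      omega
    rw [e, Finset.sum_insert, Finset.sum_insert, ih,
      Finset.sum_Ico_succ_top (show 1 ≤ μ + 1 by omega)]
    · ring
    · simp only [Finset.mem_Icc]; omega
    · simp only [Finset.mem_Icc, Finset.mem_insert]; omega

lemma sum_range_sub (f : ℕ → ℂ) (μ : ℕ) :
    ∑ r ∈ Finset.range μ, f (μ - r) = ∑ l ∈ Finset.Ico 1 (μ + 1), f l :=
  Finset.sum_nbij' (fun r => μ - r) (fun l => μ - l)
    (by simp only [Finset.mem_range, Finset.mem_Ico]; omega)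
    (by simp only [Finset.mem_range, Finset.mem_Ico]; omega)
    (by simp only [Finset.mem_range]; omega)
    (by simp only [Finset.mem_Ico]; omega)
    (by simp)

lemma residueSum_zero_eq (hκ : κ * κ = 1) (g : ℂ → ℂ) : residueSum κ μ (0 : ZMod n) g =
    ∑ l ∈ Finset.Ico 1 (μ + 1), if (l : ZMod n) = μ then κ ^ μ * κ ^ l * g l else 0 := by
  rw [← sum_range_sub, residueSum]
  refine Finset.sum_congr rfl fun r hr => ?_
  have hr' : r ≤ μ := (Finset.mem_range.1 hr).le
  have hpow : κ ^ μ * κ ^ (μ - r) = κ ^ r := by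
    obtain ⟨u, rfl⟩ := Nat.exists_eq_add_of_le hr'
    rw [Nat.add_sub_cancel_left, pow_add, mul_assoc, ← mul_pow, hκ, one_pow, mul_one]
  rw [hpow, Nat.cast_sub hr', Nat.cast_sub hr']
  exact if_congr (by rw [sub_eq_self]) rfl rfl

lemma model_zero_eq_sum (hκ : κ * κ = 1) (hμ : 0 < μ) (φ : ℂ → ℂ) :
    2 * τ / n * model κ μ (0 : ZMod n) φ =
      κ ^ μ * ∑ l ∈ Finset.Icc (-(μ : ℤ)) μ, laurentCoeff n μ τ l * κ ^ l * φ l := by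
  have hinv : ∀ l : ℕ, κ ^ (-(l : ℤ)) = κ ^ l := by
    intro l
    rw [zpow_neg, zpow_natCast, ← inv_pow, inv_eq_of_mul_eq_one_left hκ]
  -- The correction `-μ φ(-μ)` in `model` cancels the evaluation at `-μ`; this is why the
  -- coefficient at `-μ` is zero while the one at `μ` is not.
  have hterm : ∀ l ∈ Finset.Ico 1 (μ + 1),
      κ ^ μ * (laurentCoeff n μ τ l * κ ^ (l : ℤ) * φ (l : ℤ) +
        laurentCoeff n μ τ (-(l : ℤ)) * κ ^ (-(l : ℤ)) * φ ((-(l : ℤ) : ℤ) : ℂ)) =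
      2 * τ / n * (if (l : ZMod n) = μ then κ ^ μ * κ ^ l * (l * φ l) else 0) +
        2 * τ / n * (if (l : ZMod n) = μ then κ ^ μ * κ ^ l * (l * φ (-l)) else 0) -
        if l = μ then κ ^ μ * κ ^ μ * (2 * τ / n * (μ * φ (-μ))) else 0 := by
    intro l hl
    rw [Finset.mem_Ico] at hl
    have h1 : (l : ℤ) ≠ -(μ : ℤ) := by omega
    have h2 : (-(l : ℤ) ≠ -(μ : ℤ)) ↔ l ≠ μ := by omega
    rw [hinv, zpow_natCast, laurentCoeff, laurentCoeff, Int.natAbs_neg, Int.natAbs_natCast]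
    simp only [h1, h2, ne_eq, not_false_eq_true, and_true, Int.cast_neg, Int.cast_natCast]
    by_cases hlm : l = μ
    · subst hlm
      simp only [not_true_eq_false, and_false, if_false, if_true]
      ring
    · by_cases hlz : (l : ZMod n) = μ
      · simp only [hlm, hlz, not_false_eq_true, and_self, if_true, if_false]
        ring
      · simp only [hlm, hlz, not_false_eq_true, false_and, if_false]
        ring
  have h0 : laurentCoeff n μ τ 0 = 0 := by simp [laurentCoeff]
  have hκμ : κ ^ μ * κ ^ μ = 1 := by rw [← mul_pow, hκ, one_pow]
  rw [sum_Icc_neg_natCast, h0, zero_mul, zero_mul, zero_add, Finset.mul_sum,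
    Finset.sum_congr rfl hterm, Finset.sum_sub_distrib, Finset.sum_add_distrib, ← Finset.mul_sum,
    ← Finset.mul_sum, ← residueSum_zero_eq hκ (fun l => l * φ l),
    ← residueSum_zero_eq hκ (fun l => l * φ (-l)), Finset.sum_ite_eq', if_pos (by simp; omega),
    hκμ, model_apply, if_pos rfl, neg_zero]
  ring

end laurent

/-! ### Generating functions -/

section generating

variable {n : ℕ} [NeZero n] {ν κ τ : ℂ} {sp : H n ν →ₗ[ℂ] ℂ} {μ : ℕ}

lemma Q_zero_mul_Q_zero : Q n ν 0 * Q n ν 0 = Q n ν 0 := by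
  conv_lhs => rw [← L_zero_mul_L_zero, mul_assoc, L_zero_mul_L_zero, L_zero_mul_Q_zero]
  exact L_zero_mul_L_zero

/-- On the idempotent `Q₀`, `𝔰²` acts as `(𝔰 - iμL₀)² + μ²`, and the binomial theorem applies. -/
lemma sing_pow_mul_Q_zero (j : ℕ) : sing n ν ^ (2 * j) * Q n ν 0 =
    ∑ m ∈ Finset.range (j + 1), ((j.choose m : ℂ) * (((n : ℂ) * ν) ^ 2) ^ (j - m)) •
      (singSub n ν ^ (2 * m) * Q n ν 0) := by
  set x : H n ν := singSub n ν ^ 2 + algebraMap ℂ _ (((n : ℂ) * ν) ^ 2) with hx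
  have h1 : sing n ν ^ 2 * Q n ν 0 = x * Q n ν 0 := by
    rw [hx, singSub_sq, add_mul, sub_mul, smul_mul_assoc, Q_zero_mul_Q_zero, ← Algebra.smul_def,
      sub_add_cancel]
  have hpow : (sing n ν ^ 2) ^ j * Q n ν 0 = x ^ j * Q n ν 0 := by
    induction j with
    | zero => simp
    | succ j ih =>
      have hc : Commute (Q n ν 0) (x ^ j) :=
        (((commute_Q_singSub 0).pow_right 2).add_right (Algebra.commutes _ _).symm).pow_right j
      rw [pow_succ', mul_assoc, ih, ← hc.eq, ← mul_assoc, h1, mul_assoc, hc.eq, ← mul_assoc,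
        ← pow_succ']
  have hcomm : Commute (singSub n ν ^ 2) (algebraMap ℂ _ (((n : ℂ) * ν) ^ 2)) :=
    (Algebra.commutes _ _).symm
  rw [pow_mul, hpow, hx, hcomm.add_pow, Finset.sum_mul]
  refine Finset.sum_congr rfl fun m _ => ?_
  rw [← map_pow, ← map_natCast (algebraMap ℂ (H n ν)), mul_assoc (_ ^ m), ← map_mul,
    ← Algebra.commutes, ← Algebra.smul_def, mul_comm (_ ^ (j - m)), smul_mul_assoc, pow_mul]

lemma IsKTrace.sp_sing_pow_odd (h : IsKTrace κ sp) (k : ℕ) :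
    sp (sing n ν ^ (2 * k + 1) * Q n ν 0) = 0 := by
  rw [pow_succ', pow_mul]
  exact h.sp_sing_mul_Q (by simp) (commute_L_zero_sing_sq.pow_right k)

variable (hn : Odd n) (hμ : 0 < μ) (hdvd : ¬ n ∣ μ) (hν : (n : ℂ) * ν = (μ : ℂ))

include hn hμ hdvd hν

lemma IsSpZ.sp_singSub_pow (hκ : κ = 1 ∨ κ = -1) (h : IsSpZ κ (μ : ℤ) τ sp) (j : ℕ) :
    sp (singSub n ν ^ j * Q n ν 0) = κ ^ μ * ∑ l ∈ Finset.Icc (-(μ : ℤ)) μ,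
      laurentCoeff n μ τ l * κ ^ l * (Complex.I * l) ^ j := by
  have hκ2 : κ * κ = 1 := by rcases hκ with rfl | rfl <;> norm_num
  rw [h.moment_eq hn hμ hdvd hν hκ, model_zero_eq_sum hκ2 hμ]

lemma IsSpZ.sp_sing_pow_even (hκ : κ = 1 ∨ κ = -1) (h : IsSpZ κ (μ : ℤ) τ sp) (j : ℕ) :
    sp (sing n ν ^ (2 * j) * Q n ν 0) = κ ^ μ * ∑ l ∈ Finset.Icc (-(μ : ℤ)) μ,
      laurentCoeff n μ τ l * κ ^ l * ((μ : ℂ) ^ 2 - (l : ℂ) ^ 2) ^ j := by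
  simp only [sing_pow_mul_Q_zero, map_sum, map_smul, smul_eq_mul,
    h.sp_singSub_pow hn hμ hdvd hν hκ, hν]
  simp only [Finset.mul_sum]
  rw [Finset.sum_comm]
  refine Finset.sum_congr rfl fun l _ => ?_
  have e : (μ : ℂ) ^ 2 - (l : ℂ) ^ 2 = (Complex.I * l) ^ 2 + (μ : ℂ) ^ 2 := by
    linear_combination -(l : ℂ) ^ 2 * Complex.I_mul_I
  rw [e, add_pow, Finset.mul_sum, Finset.mul_sum]
  exact Finset.sum_congr rfl fun m _ => by rw [pow_mul]; ring

lemma IsSpZ.hasSum_singSub (hκ : κ = 1 ∨ κ = -1) (h : IsSpZ κ (μ : ℤ) τ sp) (t : ℂ) :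
    HasSum (expTerm sp (singSub n ν) (Q n ν 0) t) (κ ^ μ * ∑ l ∈ Finset.Icc (-(μ : ℤ)) μ,
      laurentCoeff n μ τ l * (κ * Complex.exp (Complex.I * t)) ^ l) := by
  have hs : HasSum (fun j : ℕ => κ ^ μ * ∑ l ∈ Finset.Icc (-(μ : ℤ)) μ,
      laurentCoeff n μ τ l * κ ^ l * ((l * (Complex.I * t)) ^ j / (j.factorial : ℂ)))
      (κ ^ μ * ∑ l ∈ Finset.Icc (-(μ : ℤ)) μ,
        laurentCoeff n μ τ l * κ ^ l * Complex.exp (l * (Complex.I * t))) := by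
    refine (hasSum_sum fun l _ => HasSum.mul_left _ ?_).mul_left _
    rw [Complex.exp_eq_exp_ℂ]
    exact NormedSpace.expSeries_div_hasSum_exp _
  convert hs using 1
  · funext j
    rw [expTerm, h.sp_singSub_pow hn hμ hdvd hν hκ, mul_left_comm, Finset.mul_sum]
    congr 1
    exact Finset.sum_congr rfl fun l _ => by rw [mul_pow, mul_pow, mul_pow]; ring
  · congr 1
    exact Finset.sum_congr rfl fun l _ => by rw [mul_zpow, Complex.exp_int_mul, mul_assoc]

lemma IsSpZ.hasSum_cosh_sing (hκ : κ = 1 ∨ κ = -1) (h : IsSpZ κ (μ : ℤ) τ sp) (t : ℂ) :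
    HasSum (fun j : ℕ => t ^ (2 * j) / ((2 * j).factorial : ℂ) *
        sp (sing n ν ^ (2 * j) * Q n ν 0))
      (κ ^ μ * ∑ l ∈ Finset.Icc (-(μ : ℤ)) μ, laurentCoeff n μ τ l * κ ^ l *
        Complex.cosh (t * (Real.sqrt ((μ : ℝ) ^ 2 - (l : ℝ) ^ 2) : ℂ))) := by
  have hs : HasSum (fun j : ℕ => κ ^ μ * ∑ l ∈ Finset.Icc (-(μ : ℤ)) μ,
      laurentCoeff n μ τ l * κ ^ l * ((t * (Real.sqrt ((μ : ℝ) ^ 2 - (l : ℝ) ^ 2) : ℂ)) ^ (2 * j) /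
        ((2 * j).factorial : ℂ)))
      (κ ^ μ * ∑ l ∈ Finset.Icc (-(μ : ℤ)) μ, laurentCoeff n μ τ l * κ ^ l *
        Complex.cosh (t * (Real.sqrt ((μ : ℝ) ^ 2 - (l : ℝ) ^ 2) : ℂ))) :=
    (hasSum_sum fun l _ => (Complex.hasSum_cosh _).mul_left _).mul_left _
  convert hs using 1
  funext j
  rw [h.sp_sing_pow_even hn hμ hdvd hν hκ, mul_left_comm, Finset.mul_sum]
  congr 1
  refine Finset.sum_congr rfl fun l hl => ?_
  rw [Finset.mem_Icc] at hl
  -- The real square root is genuine because `|l| ≤ μ`.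
  have hle : (0 : ℝ) ≤ (μ : ℝ) ^ 2 - (l : ℝ) ^ 2 := by
    rw [sub_nonneg, sq_le_sq, ← Int.cast_abs, Nat.abs_cast]
    exact_mod_cast abs_le.2 hl
  have hsq : ((Real.sqrt ((μ : ℝ) ^ 2 - (l : ℝ) ^ 2) : ℝ) : ℂ) ^ 2 =
      (μ : ℂ) ^ 2 - (l : ℂ) ^ 2 := by
    rw [← Complex.ofReal_pow, Real.sq_sqrt hle]
    push_cast
    rfl
  rw [mul_pow, pow_mul (_ : ℂ) 2 j, pow_mul (Complex.ofReal _) 2 j, hsq]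
  ring

lemma IsSpZ.hasSum_sing (hκ : κ = 1 ∨ κ = -1) (h : IsSpZ κ (μ : ℤ) τ sp) (t : ℂ) :
    HasSum (expTerm sp (sing n ν) (Q n ν 0) t)
      (κ ^ μ * ∑ l ∈ Finset.Icc (-(μ : ℤ)) μ, laurentCoeff n μ τ l * κ ^ l *
        Complex.cosh (t * (Real.sqrt ((μ : ℝ) ^ 2 - (l : ℝ) ^ 2) : ℂ))) := by
  have hodd : HasSum (fun k => expTerm sp (sing n ν) (Q n ν 0) t (2 * k + 1)) 0 := by
    simp only [expTerm, h.isKTrace.sp_sing_pow_odd, mul_zero]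
    exact hasSum_zero
  simpa using (h.hasSum_cosh_sing hn hμ hdvd hν hκ t).even_add_odd hodd

omit [NeZero n] hn hdvd hν in
lemma sum_laurentCoeff_cosh (hκ : κ = 1 ∨ κ = -1) (t : ℂ) :
    κ ^ μ * ∑ l ∈ Finset.Icc (-(μ : ℤ)) μ, laurentCoeff n μ τ l * κ ^ l *
        Complex.cosh (t * (Real.sqrt ((μ : ℝ) ^ 2 - (l : ℝ) ^ 2) : ℂ)) =
      laurentCoeff n μ τ μ + κ ^ μ * (laurentCoeff n μ τ 0 + 2 * ∑ l ∈ Finset.Ico 1 μ,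
        κ ^ l * laurentCoeff n μ τ l *
          Complex.cosh (t * (Real.sqrt ((μ : ℝ) ^ 2 - (l : ℝ) ^ 2) : ℂ))) := by
  have hκ2 : κ * κ = 1 := by rcases hκ with rfl | rfl <;> norm_num
  have hκμ : κ ^ μ * κ ^ μ = 1 := by rw [← mul_pow, hκ2, one_pow]
  have hinv : ∀ l : ℕ, κ ^ (-(l : ℤ)) = κ ^ l := by
    intro l
    rw [zpow_neg, zpow_natCast, ← inv_pow, inv_eq_of_mul_eq_one_left hκ2]
  have h0 : laurentCoeff n μ τ 0 = 0 := by simp [laurentCoeff]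
  have hneg : laurentCoeff n μ τ (-(μ : ℤ)) = 0 := by simp [laurentCoeff]
  have hsum : ∑ l ∈ Finset.Ico 1 μ, (laurentCoeff n μ τ l * κ ^ (l : ℤ) *
        Complex.cosh (t * (Real.sqrt ((μ : ℝ) ^ 2 - ((l : ℤ) : ℝ) ^ 2) : ℂ)) +
      laurentCoeff n μ τ (-(l : ℤ)) * κ ^ (-(l : ℤ)) *
        Complex.cosh (t * (Real.sqrt ((μ : ℝ) ^ 2 - ((-(l : ℤ) : ℤ) : ℝ) ^ 2) : ℂ))) =
      2 * ∑ l ∈ Finset.Ico 1 μ, κ ^ l * laurentCoeff n μ τ l *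
          Complex.cosh (t * (Real.sqrt ((μ : ℝ) ^ 2 - (l : ℝ) ^ 2) : ℂ)) := by
    rw [Finset.mul_sum]
    refine Finset.sum_congr rfl fun l hl => ?_
    rw [Finset.mem_Ico] at hl
    have hc : laurentCoeff n μ τ (-(l : ℤ)) = laurentCoeff n μ τ l := by
      have h1 : (l : ℤ) ≠ -(μ : ℤ) := by omega
      have h2 : -(l : ℤ) ≠ -(μ : ℤ) := by omega
      simp only [laurentCoeff, Int.natAbs_neg, h1, h2, ne_eq, not_false_eq_true]
    rw [hc, hinv, zpow_natCast, Int.cast_neg, Int.cast_natCast, neg_sq]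
    ring
  -- At `l = μ` the root vanishes and `cosh 0 = 1`; the factor `κ^μ κ^μ = 1` leaves the constant
  -- `α_μ`.
  rw [sum_Icc_neg_natCast, Finset.sum_Ico_succ_top (by omega), hsum, h0, hneg, zpow_natCast,
    Int.cast_natCast, sub_self, Real.sqrt_zero, Complex.ofReal_zero, mul_zero, Complex.cosh_zero]
  linear_combination laurentCoeff n μ τ μ * hκμ

end generating

end SRA

theorem mainTheorem2 (n : ℕ) [NeZero n] (hn : Odd n) (ν : ℂ) (μ : ℕ) (hμ : 0 < μ)
    (hdvd : ¬ n ∣ μ) (hν : (n : ℂ) * ν = (μ : ℂ)) (τ : ℂ) (hτ : τ ≠ 0) :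
    ∃ α : ℤ → ℂ, α (μ : ℤ) ≠ 0 ∧
      ∀ κ : ℂ, (κ = 1 ∨ κ = -1) → ∀ sp : SRA.H n ν →ₗ[ℂ] ℂ,
        SRA.IsSpZ κ (μ : ℤ) τ sp →
        -- `α ℓ` are the Laurent coefficients of `F₀`
        (∀ t : ℂ,
          Summable (SRA.expTerm sp
            (SRA.sing n ν - (Complex.I * (μ : ℂ)) • SRA.L n ν 0) (SRA.Q n ν 0) t) ∧
          SRA.expGen sp
              (SRA.sing n ν - (Complex.I * (μ : ℂ)) • SRA.L n ν 0) (SRA.Q n ν 0) t =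
            κ ^ μ * ∑ l ∈ Finset.Icc (-(μ : ℤ)) (μ : ℤ),
              α l * (κ * Complex.exp (Complex.I * t)) ^ l) ∧
        -- `𝓕` converges everywhere, is even, and equals `sp (cosh (t 𝔰) Q₀)`
        (∀ t : ℂ, Summable (SRA.expTerm sp (SRA.sing n ν) (SRA.Q n ν 0) t) ∧
          SRA.expGen sp (SRA.sing n ν) (SRA.Q n ν 0) (-t) =
            SRA.expGen sp (SRA.sing n ν) (SRA.Q n ν 0) t ∧
          HasSum (fun j : ℕ => t ^ (2 * j) / ((2 * j).factorial : ℂ) *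
              sp (SRA.sing n ν ^ (2 * j) * SRA.Q n ν 0))
            (SRA.expGen sp (SRA.sing n ν) (SRA.Q n ν 0) t)) ∧
        -- the closed formula for `𝓕`
        (∀ t : ℂ, SRA.expGen sp (SRA.sing n ν) (SRA.Q n ν 0) t =
          α (μ : ℤ) + κ ^ μ * (α 0 + 2 * ∑ l ∈ Finset.Ico 1 μ,
            κ ^ l * α (l : ℤ) *
              Complex.cosh (t * (Real.sqrt ((μ : ℝ) ^ 2 - (l : ℝ) ^ 2) : ℂ)))) := by
  have hn0 : (n : ℂ) ≠ 0 := Nat.cast_ne_zero.2 (NeZero.ne n)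
  have hμ0 : (μ : ℂ) ≠ 0 := Nat.cast_ne_zero.2 hμ.ne'
  refine ⟨SRA.laurentCoeff n μ τ, ?_, fun κ hκ sp h => ?_⟩
  · rw [SRA.laurentCoeff, if_pos ⟨by simp, by omega⟩, Int.natAbs_natCast]
    exact mul_ne_zero (div_ne_zero (mul_ne_zero two_ne_zero hτ) hn0) hμ0
  have hx : SRA.sing n ν - (Complex.I * (μ : ℂ)) • SRA.L n ν 0 = SRA.singSub n ν := by
    rw [SRA.singSub, hν]
  have hF : ∀ t, SRA.expGen sp (SRA.sing n ν) (SRA.Q n ν 0) t = _ := fun t =>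
    (h.hasSum_sing hn hμ hdvd hν hκ t).tsum_eq
  refine ⟨fun t => ?_, fun t => ⟨(h.hasSum_sing hn hμ hdvd hν hκ t).summable, ?_, ?_⟩,
    fun t => ?_⟩
  · rw [hx]
    have hs := h.hasSum_singSub hn hμ hdvd hν hκ t
    exact ⟨hs.summable, hs.tsum_eq⟩
  · simp only [hF, neg_mul, Complex.cosh_neg]
  · rw [hF]
    exact h.hasSum_cosh_sing hn hμ hdvd hν hκ t
  · rw [hF]
    exact SRA.sum_laurentCoeff_cosh hμ hκ t
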